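/- Let $V\ge 1$ and let $s(1),\dots,s(V)\ge 0$ with $\sum_j s(j)=1$ and $s(V)\neq 0$. In the LRU stack model, $V$ items are kept in a stack ordered by recency; at each step an independent depth $d$ with $\Pr[d=j]=s(j)$ is drawn, the item at depth $d$ is accessed, and it moves to the top while the items above it move down by one. *Single item.* A stationary single-item policy is a set of depths at which the item is evicted from the buffer when it gets there (it re-enters the buffer when it is next accessed, and an access while it is out is a miss). Its cost point is the pair (long-run average occupancy, long-run expected miss rate of this item), for an item started at the top of the stack and in the buffer. Let $\mathrm{ev}_k$ be the policy that keeps the item at depths $\le k$ and evicts it at depths $>k$. The policy $\mathrm{ev}_k$ is a supported efficient (Pareto-convex) policy if no convex combination of the other cost points is $\le$ its cost point in both coordinates. Let $q_1<q_2<\dots<q_l$ be the $k\in\{1,\dots,V\}$ for which $\mathrm{ev}_k$ is supported efficient. The average-occupancy optimum for occupancy $C$ is the least $V\zeta$ over the convex combinations $(\eta,\zeta)$ of cost points with $V\eta=C$. *Fixed capacity.* A buffer of capacity $C$ always receives the accessed item; when a miss occurs and the buffer is full, exactly one item in it is evicted, and otherwise nothing is. Policies may depend on the time, the state (stack and buffer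 content) and the current depth $d$. The $K$-$L$ policy evicts, on a miss with full buffer and in terms of the stack just after the update, the item at depth $L+1$ if it is in the buffer, otherwise the item at depth $K+1$ (and, should neither be in the buffer, the least recently used item of the buffer). A policy is gain optimal with miss rate $M$ if, from the empty buffer and any initial stack, its expected number of misses in $\tau$ steps divided by $\tau$ tends to $M$, and no policy for capacity $C$, from any initial state, has a lower limit of this ratio below $M$. *Algorithm* (on input $V$ and $s$): 1. $\nu[1]\leftarrow 1$, $\pi[1]\leftarrow s(1)$, $\Delta[1]\leftarrow 1$, $\pi[V+1]\leftarrow 0$, $\Delta[V+1]\leftarrow 1$. 2. For $j=V$ down to $2$: $\nu[j]\leftarrow j$, $\pi[j]\leftarrow s(j)$, $\Delta[j]\leftarrow 1$, $n\leftarrow \nu[j]+1$; while $\pi[j]/\Delta[j]\le \pi[n]/\Delta[n]$: $\nu[j]\leftarrow\nu[n]$, $\pi[j]\leftarrow\pi[j]+\pi[n]$, $\Delta[j]\leftarrow\Delta[j]+\Delta[n]$, $n\leftarrow\nu[j]+1$. 3. $j\leftarrow 1$, $i\leftarrow 1$; while $j\le V$: print "$q_i=\nu[j]$", $j\leftarrow\nu[j]+1$,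 $i\leftarrow i+1$. 4. For $j=2,\dots,V$: print "$\xi(j)=\pi[j]/\Delta[j]$". **Claim.** $q_1=1$ and $q_l=V$, and the lines printed in step 3 are exactly the values $q_1,\dots,q_l$, in order. On a real RAM with unit cost the algorithm runs in time $\Theta(V)$: between $c_1V$ and $c_2V$ for absolute constants $c_1,c_2>0$ that depend neither on $V$ nor on $s$. Moreover, with the convention $q_0=0$, for every integer $1\le C\le V$ there is exactly one pair of consecutive values $K(C)=q_i<C\le q_{i+1}=L(C)$, and the $K(C)$-$L(C)$ policy is gain optimal for the fixed capacity $C$; its miss rate equals the average-occupancy optimum for occupancy $C$. -/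

import Mathlib

namespace LRUSM

/-! ### Long-run expected costs of a system driven by i.i.d. stack depths

A stack distance is an element `d : Fin V`; it stands for the depth `d + 1 ∈ {1, …, V}`.
The stack-distance distribution is a function `s : ℕ → ℝ`, of which only the values
`s 1, …, s V` matter. -/

/-- `s 1, …, s V` is a probability distribution whose last entry is not zero. -/
structure IsStackDistribution (V : ℕ) (s : ℕ → ℝ) : Prop where
  nonneg : ∀ j, 1 ≤ j → j ≤ V → 0 ≤ s j
  sum_eq_one : ∑ j ∈ Finset.Icc 1 V, s j = 1
  last_ne_zero : s V ≠ 0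

/-- The cost accumulated from time `t` and state `x` on, along a finite list of disturbances, by
the system that moves from `x` to `step t x w` and pays `g x w` on disturbance `w`. -/
def totalCost {X W : Type} (g : X → W → ℝ) (step : ℕ → X → W → X) : ℕ → X → List W → ℝ
  | _, _, [] => 0
  | t, x, w :: ws => g x w + totalCost g step (t + 1) (step t x w) ws

/-- The expected cost over the first `τ` steps, started in `x₀` at time `0`, when the `τ`
disturbances are independent stack distances with distribution `s`. -/
noncomputable def expectedCost {V : ℕ} {X : Type} (s : ℕ → ℝ) (g : X → Fin V → ℝ)
    (step : ℕ → X → Fin V → X) (x₀ : X) (τ : ℕ) : ℝ :=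
  ∑ w : Fin τ → Fin V,
    (∏ t, s ((w t : ℕ) + 1)) * totalCost g step 0 x₀ (List.ofFn w)

/-- The expected cost per step converges to `G`. -/
def HasAverageCost {V : ℕ} {X : Type} (s : ℕ → ℝ) (g : X → Fin V → ℝ)
    (step : ℕ → X → Fin V → X) (x₀ : X) (G : ℝ) : Prop :=
  Filter.Tendsto (fun τ : ℕ => expectedCost s g step x₀ τ / τ) Filter.atTop (nhds G)

/-! ### The average occupancy problem for a single item -/

/-- The state of a single item: its position in the LRU stack (`0` is the top of the stack), and
whether it is in the buffer. -/
abbrev ItemState (V : ℕ) : Type := Fin V × Bool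

/-- An item at position `z` is accessed when the stack distance `d` equals `z`, and is then moved
to the top and into the buffer. Otherwise it moves one position down if `z < d` and stays if
`d < z`; it leaves the buffer if the stationary policy `e` evicts at the position reached.
(`Fin.cycleRange d` sends `d` to `0`, each `z < d` to `z + 1`, and fixes each `z > d`.) -/
def itemStep {V : ℕ} (e : Fin V → Bool) (_t : ℕ) (x : ItemState V) (d : Fin V) : ItemState V :=
  (Fin.cycleRange d x.1, if d = x.1 then true else x.2 && !e (Fin.cycleRange d x.1))

/-- Instantaneous occupancy cost. -/
def itemOccupancy {V : ℕ} (x : ItemState V) (_d : Fin V) : ℝ := if x.2 = true then 1 else 0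

/-- Instantaneous miss cost: the item is accessed while it is not in the buffer. -/
def itemMiss {V : ℕ} (x : ItemState V) (d : Fin V) : ℝ :=
  if x.2 = false ∧ d = x.1 then 1 else 0

/-- `p` is the pair (average occupancy, miss rate) of the single-item policy `e`, for the item
started at the top of the stack and in the buffer. -/
def HasItemCosts {V : ℕ} [NeZero V] (s : ℕ → ℝ) (e : Fin V → Bool) (p : ℝ × ℝ) : Prop :=
  HasAverageCost s itemOccupancy (itemStep e) ((0, true) : ItemState V) p.1 ∧
  HasAverageCost s itemMiss (itemStep e) ((0, true) : ItemState V) p.2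

/-- The cost points of all the stationary single-item policies. -/
def itemCostPoints (V : ℕ) [NeZero V] (s : ℕ → ℝ) : Set (ℝ × ℝ) :=
  {p | ∃ e : Fin V → Bool, HasItemCosts s e p}

/-- The policy `ev_k`: keep the item at depths `≤ k`, evict it at depths `> k`. -/
def evPolicy {V : ℕ} (k : ℕ) (i : Fin V) : Bool := decide (k < (i : ℕ) + 1)

/-- `ev_k` is a supported efficient (Pareto-convex) policy: no convex combination of the other
cost points is at most its cost point in both coordinates. -/
def IsSupportedEv (V : ℕ) [NeZero V] (s : ℕ → ℝ) (k : ℕ) : Prop :=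
  ∃ p : ℝ × ℝ, HasItemCosts (V := V) s (evPolicy k) p ∧
    ¬ ∃ y ∈ convexHull ℝ (itemCostPoints V s \ {p}), y ≤ p

/-- `M` is the optimal miss rate of the average occupancy problem with target occupancy `C`:
all the `V` items are managed by the same randomized mixture of single-item policies, the costs
of such mixtures being the convex combinations of the single-item costs. -/
def IsAverageOccupancyOptimum (V : ℕ) [NeZero V] (s : ℕ → ℝ) (C : ℝ) (M : ℝ) : Prop :=
  IsLeast {m : ℝ | ∃ p ∈ convexHull ℝ (itemCostPoints V s), V * p.1 = C ∧ V * p.2 = m} M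

/-! ### The fixed capacity problem -/

/-- State: the LRU stack (`stack i` is the item at depth `i + 1`) and the content of the buffer;
the virtual space of items is `Fin V`. -/
structure BufferState (V : ℕ) where
  stack : Equiv.Perm (Fin V)
  buffer : Finset (Fin V)

/-- The LRU stack after an access at stack distance `d`: the prefix that ends at `d` is cyclically
shifted down by one position. -/
def rotate {V : ℕ} (Λ : Equiv.Perm (Fin V)) (d : Fin V) : Equiv.Perm (Fin V) :=
  (Fin.cycleRange d).symm.trans Λ

/-- A possibly time-dependent policy, which knows the state and the current stack distance; the
control is the item to be evicted, if any. -/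
abbrev Policy (V : ℕ) : Type := ℕ → BufferState V → Fin V → Option (Fin V)

/-- Controls admissible for a buffer of fixed capacity `C`: an item of the buffer is evicted if
a miss occurs while the buffer is full, and no eviction is made otherwise. -/
def AdmissibleControl {V : ℕ} (C : ℕ) (x : BufferState V) (d : Fin V) (u : Option (Fin V)) :
    Prop :=
  if x.stack d ∉ x.buffer ∧ x.buffer.card = C then ∃ j ∈ x.buffer, u = some j else u = none

/-- A policy for a buffer of fixed capacity `C`. -/
def Policy.Admissible {V : ℕ} (C : ℕ) (μ : Policy V) : Prop :=
  ∀ t x d, x.buffer.card ≤ C → AdmissibleControl C x d (μ t x d)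

/-- One step of the controlled system: the stack is rotated, the control is evicted, and the
accessed item is in the buffer afterwards. -/
def bufferStep {V : ℕ} (μ : Policy V) (t : ℕ) (x : BufferState V) (d : Fin V) : BufferState V where
  stack := rotate x.stack d
  buffer := insert (x.stack d) (x.buffer \ (μ t x d).toFinset)

/-- The cost is one on a miss and zero on a hit. -/
def bufferMiss {V : ℕ} (x : BufferState V) (d : Fin V) : ℝ :=
  if x.stack d ∈ x.buffer then 0 else 1

/-- The policy `μ` for capacity `C` is gain optimal, with miss rate `M`: started from the empty
buffer and any stack it has long-run expected miss rate `M`, and for no admissible policy and no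
initial state is the lower limit of the expected miss rate smaller than `M`. -/
def IsGainOptimal {V : ℕ} (s : ℕ → ℝ) (C : ℕ) (μ : Policy V) (M : ℝ) : Prop :=
  μ.Admissible C ∧
  (∀ Λ : Equiv.Perm (Fin V), HasAverageCost s bufferMiss (bufferStep μ) ⟨Λ, ∅⟩ M) ∧
  ∀ μ' : Policy V, μ'.Admissible C → ∀ x₀ : BufferState V, x₀.buffer.card ≤ C →
    ∀ c < M, ∀ᶠ τ : ℕ in Filter.atTop,
      c < expectedCost s bufferMiss (bufferStep μ') x₀ τ / τ

/-- The `K`-`L` eviction policy for capacity `C`. On a miss with a full buffer it evicts, with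
respect to the stack right after the rotation, the item at depth `L + 1` if that is in the buffer;
otherwise the item at depth `K + 1` if that is in the buffer; otherwise (which never happens
from the empty buffer) the least recently used item of the buffer. Depth `L + 1` does not exist
if `L = V`. -/
def klPolicy {V : ℕ} (C K L : ℕ) : Policy V := fun _ x d =>
  if x.stack d ∉ x.buffer ∧ x.buffer.card = C then
    let Λ : List (Fin V) := List.ofFn (rotate x.stack d)
    (Λ[L]?.toList ++ Λ[K]?.toList ++ Λ.reverse).find? (fun j => decide (j ∈ x.buffer))
  else none

/-! ### A real RAM with unit cost

A while language over natural number registers, an array `nu` of natural numbers and arrays of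
real numbers. Evaluating a node of an expression or of a test, writing a register or a cell,
printing, and each branching of a loop cost one unit. -/

inductive NatVar
  | V | i | j | n
  deriving DecidableEq

inductive RealArr
  | s | pi | delta
  deriving DecidableEq

inductive Output
  | q (i : ℕ) (value : ℕ)
  | xi (j : ℕ) (value : ℝ)

structure Store where
  reg : NatVar → ℕ
  nu : ℕ → ℕ
  arr : RealArr → ℕ → ℝ
  /-- what has been printed, in order -/
  out : List Output

inductive NatExpr
  | lit (m : ℕ)
  | reg (x : NatVar)
  | nu (a : NatExpr)
  | add (a b : NatExpr)
  | sub (a b : NatExpr)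

inductive RealExpr
  | lit (m : ℕ)
  | arr (r : RealArr) (a : NatExpr)
  | add (a b : RealExpr)
  | div (a b : RealExpr)

inductive Test
  | natLe (a b : NatExpr)
  | realLe (a b : RealExpr)

inductive Cmd
  | setReg (x : NatVar) (a : NatExpr)
  | setNu (i a : NatExpr)
  | setArr (r : RealArr) (i : NatExpr) (a : RealExpr)
  | printQ (i a : NatExpr)
  | printXi (j : NatExpr) (a : RealExpr)
  | seq (c₁ c₂ : Cmd)
  | loop (b : Test) (c : Cmd)

def NatExpr.eval (σ : Store) : NatExpr → ℕ
  | lit m => m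
  | reg x => σ.reg x
  | nu a => σ.nu (a.eval σ)
  | add a b => a.eval σ + b.eval σ
  | sub a b => a.eval σ - b.eval σ

def NatExpr.cost : NatExpr → ℕ
  | lit _ => 1
  | reg _ => 1
  | nu a => a.cost + 1
  | add a b => a.cost + b.cost + 1
  | sub a b => a.cost + b.cost + 1

noncomputable def RealExpr.eval (σ : Store) : RealExpr → ℝ
  | lit m => m
  | arr r a => σ.arr r (a.eval σ)
  | add a b => a.eval σ + b.eval σ
  | div a b => a.eval σ / b.eval σ

def RealExpr.cost : RealExpr → ℕ
  | lit _ => 1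
  | arr _ a => a.cost + 1
  | add a b => a.cost + b.cost + 1
  | div a b => a.cost + b.cost + 1

def Test.holds (σ : Store) : Test → Prop
  | natLe a b => a.eval σ ≤ b.eval σ
  | realLe a b => a.eval σ ≤ b.eval σ

def Test.cost : Test → ℕ
  | natLe a b => a.cost + b.cost + 1
  | realLe a b => a.cost + b.cost + 1

/-- `Exec c σ σ' T`: the command `c`, started in the store `σ`, terminates in the store `σ'` after
`T` units of time. -/
inductive Exec : Cmd → Store → Store → ℕ → Prop
  | setReg (x : NatVar) (a : NatExpr) (σ : Store) :
      Exec (.setReg x a) σ { σ with reg := Function.update σ.reg x (a.eval σ) } (a.cost + 1)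
  | setNu (i a : NatExpr) (σ : Store) :
      Exec (.setNu i a) σ { σ with nu := Function.update σ.nu (i.eval σ) (a.eval σ) }
        (i.cost + a.cost + 1)
  | setArr (r : RealArr) (i : NatExpr) (a : RealExpr) (σ : Store) :
      Exec (.setArr r i a) σ
        { σ with arr := Function.update σ.arr r
                          (Function.update (σ.arr r) (i.eval σ) (a.eval σ)) }
        (i.cost + a.cost + 1)
  | printQ (i a : NatExpr) (σ : Store) :
      Exec (.printQ i a) σ { σ with out := σ.out ++ [Output.q (i.eval σ) (a.eval σ)] }
        (i.cost + a.cost + 1)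
  | printXi (j : NatExpr) (a : RealExpr) (σ : Store) :
      Exec (.printXi j a) σ { σ with out := σ.out ++ [Output.xi (j.eval σ) (a.eval σ)] }
        (j.cost + a.cost + 1)
  | seq {c₁ c₂ : Cmd} {σ σ₁ σ₂ : Store} {T₁ T₂ : ℕ} :
      Exec c₁ σ σ₁ T₁ → Exec c₂ σ₁ σ₂ T₂ → Exec (.seq c₁ c₂) σ σ₂ (T₁ + T₂)
  | loopExit {b : Test} {c : Cmd} {σ : Store} :
      ¬ b.holds σ → Exec (.loop b c) σ σ (b.cost + 1)
  | loopStep {b : Test} {c : Cmd} {σ σ₁ σ₂ : Store} {T₁ T₂ : ℕ} :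
      b.holds σ → Exec c σ σ₁ T₁ → Exec (.loop b c) σ₁ σ₂ T₂ →
      Exec (.loop b c) σ σ₂ (b.cost + 1 + T₁ + T₂)

/-! ### The specialized Graham scan -/

local infixr:40 ";;" => Cmd.seq

section Program

open NatVar RealArr

/-- `π[a] / Δ[a]` -/
def ratio (a : NatExpr) : RealExpr := .div (.arr pi a) (.arr delta a)

/-- `n ← ν[j] + 1` -/
def setNext : Cmd := .setReg n (.add (.nu (.reg j)) (.lit 1))

/-- Initialization of cell `1` and of the sentinel cell `V + 1`. -/
def scanInit : Cmd :=
  .setNu (.lit 1) (.lit 1) ;;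
  .setArr pi (.lit 1) (.arr s (.lit 1)) ;;
  .setArr delta (.lit 1) (.lit 1) ;;
  .setArr pi (.add (.reg V) (.lit 1)) (.lit 0) ;;
  .setArr delta (.add (.reg V) (.lit 1)) (.lit 1)

/-- `while π[j]/Δ[j] ≤ π[n]/Δ[n]`: merge the block that starts at `n` into the one at `j`. -/
def scanMerge : Cmd :=
  .loop (.realLe (ratio (.reg j)) (ratio (.reg n))) (
    .setNu (.reg j) (.nu (.reg n)) ;;
    .setArr pi (.reg j) (.add (.arr pi (.reg j)) (.arr pi (.reg n))) ;;
    .setArr delta (.reg j) (.add (.arr delta (.reg j)) (.arr delta (.reg n))) ;;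
    setNext)

/-- `for j ← V downto 2` -/
def scanMain : Cmd :=
  .setReg j (.reg V) ;;
  .loop (.natLe (.lit 2) (.reg j)) (
    .setNu (.reg j) (.reg j) ;;
    .setArr pi (.reg j) (.arr s (.reg j)) ;;
    .setArr delta (.reg j) (.lit 1) ;;
    setNext ;;
    scanMerge ;;
    .setReg j (.sub (.reg j) (.lit 1)))

/-- Print the segmentation `q₁, q₂, …`. -/
def scanPrintQ : Cmd :=
  .setReg j (.lit 1) ;;
  .setReg i (.lit 1) ;;
  .loop (.natLe (.reg j) (.reg V)) (
    .printQ (.reg i) (.nu (.reg j)) ;;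
    .setReg j (.add (.nu (.reg j)) (.lit 1)) ;;
    .setReg i (.add (.reg i) (.lit 1)))

/-- Print the priorities `ξ(2), …, ξ(V)`. -/
def scanPrintXi : Cmd :=
  .setReg j (.lit 2) ;;
  .loop (.natLe (.reg j) (.reg V)) (
    .printXi (.reg j) (ratio (.reg j)) ;;
    .setReg j (.add (.reg j) (.lit 1)))

/-- The whole algorithm. -/
def grahamScan : Cmd := scanInit ;; scanMain ;; scanPrintQ ;; scanPrintXi

end Program

/-- The initial stores: register `V` holds `V`, array `s` holds `s 1, …, s V`, nothing has been
printed; all the rest of the memory is arbitrary. -/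
structure IsInput (V : ℕ) (s : ℕ → ℝ) (σ : Store) : Prop where
  reg_V : σ.reg .V = V
  arr_s : ∀ j, 1 ≤ j → j ≤ V → σ.arr .s j = s j
  out_nil : σ.out = []

/-- The pairs `(value, i)` of the printed lines `q_i = value`, in order. -/
def printedQ (o : List Output) : List (ℕ × ℕ) :=
  o.filterMap fun
    | .q i v => some (v, i)
    | .xi _ _ => none

end LRUSM

/-!
A bounded solution `h` of the Poisson equation `G + h x = E [g x d + h (step x d)]` shows that the
expected cost over `τ` steps is `G τ + O(1)`; a subsolution gives the lower bound alone, a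
supersolution the upper bound. For an item that moves between two of its accesses, potentials of
the form `a z / tail s z` turn the equation into a telescoping sum.

A single item that is evicted at the depth `k + 1` and not before has the cost point
`(k / V, (1 - s 1 - ⋯ - s k) / V)`, whatever the other depths of eviction are. The supported
efficient policies `ev_k` are therefore the vertices of the concave hull of the partial sums of `s`
on `{1, …, V}`. The slope `r` of the hull between two consecutive vertices `K < C ≤ L` is the
Lagrange multiplier of the occupancy constraint.

For a fixed capacity, the sum over the items of the single-item potentials at the price `r` is a
subsolution for every policy, because evicting an item never pays more than keeping it. Equality
holds when the evicted items are at depths where the price is tight; these are the depths `K + 1`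
and `L + 1`, and the `K`-`L` policy evicts only there.

The scan is Graham's: the cell `m + 1` receives the longest block that starts there and has the
largest average, which ends at the next hull vertex after `m`. Each merge removes one vertex from
the hull and each `j` adds one, so the total number of merges is less than `V`.
-/

namespace LRUSM

open Finset

/-! ### Average costs from the Poisson equation -/

section AverageCost

variable {V : ℕ} {X : Type} {s : ℕ → ℝ} {g : X → Fin V → ℝ} {step : ℕ → X → Fin V → X}
  {I : Set X} {G : ℝ} {h : X → ℝ} {x₀ : X}

/-- The expectation of `f d` for a stack distance `d` with distribution `s`. -/
noncomputable def mean (s : ℕ → ℝ) (f : Fin V → ℝ) : ℝ :=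
  ∑ d : Fin V, s (d + 1) * f d

theorem mean_add (f₁ f₂ : Fin V → ℝ) :
    mean s (fun d => f₁ d + f₂ d) = mean s f₁ + mean s f₂ := by
  simp only [mean, mul_add, sum_add_distrib]

theorem mean_neg (f : Fin V → ℝ) : mean s (fun d => -f d) = -mean s f := by
  simp only [mean, mul_neg, sum_neg_distrib]

theorem mean_const_mul (c : ℝ) (f : Fin V → ℝ) : mean s (fun d => c * f d) = c * mean s f := by
  simp only [mean, mul_sum, mul_left_comm]

theorem mean_sum {ι : Type*} (S : Finset ι) (f : ι → Fin V → ℝ) :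
    mean s (fun d => ∑ i ∈ S, f i d) = ∑ i ∈ S, mean s (f i) := by
  simp only [mean, mul_sum]
  exact sum_comm

theorem mean_const (h1 : ∑ d : Fin V, s (d + 1) = 1) (c : ℝ) :
    mean s (fun _ : Fin V => c) = c := by
  rw [mean, ← sum_mul, h1, one_mul]

theorem mean_mono (h0 : ∀ d : Fin V, 0 ≤ s (d + 1)) {f₁ f₂ : Fin V → ℝ}
    (hf : ∀ d, f₁ d ≤ f₂ d) : mean s f₁ ≤ mean s f₂ :=
  sum_le_sum fun d _ => mul_le_mul_of_nonneg_left (hf d) (h0 d)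

/-- The expected cost over `τ` steps, started in `x` at time `t`; the start at an arbitrary time
makes the recursion on the first step possible. -/
noncomputable def expectedCostFrom (s : ℕ → ℝ) (g : X → Fin V → ℝ)
    (step : ℕ → X → Fin V → X) (t : ℕ) (x : X) (τ : ℕ) : ℝ :=
  ∑ w : Fin τ → Fin V, (∏ i, s ((w i : ℕ) + 1)) * totalCost g step t x (List.ofFn w)

theorem expectedCostFrom_zero (t : ℕ) (x : X) : expectedCostFrom s g step t x 0 = 0 := by
  simp [expectedCostFrom, totalCost]

theorem sum_prod_eq_one (h1 : ∑ d : Fin V, s (d + 1) = 1) (τ : ℕ) :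
    ∑ w : Fin τ → Fin V, ∏ i, s ((w i : ℕ) + 1) = 1 := by
  rw [← Fintype.prod_sum fun (_ : Fin τ) (d : Fin V) => s ((d : ℕ) + 1)]
  simp [h1]

theorem expectedCostFrom_succ (h1 : ∑ d : Fin V, s (d + 1) = 1) (t : ℕ) (x : X) (τ : ℕ) :
    expectedCostFrom s g step t x (τ + 1) =
      mean s fun d => g x d + expectedCostFrom s g step (t + 1) (step t x d) τ := by
  rw [expectedCostFrom, ← (Fin.consEquiv fun _ : Fin (τ + 1) => Fin V).sum_comp,
    Fintype.sum_prod_type]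
  refine sum_congr rfl fun d _ => ?_
  simp only [Fin.consEquiv_apply, Fin.prod_univ_succ, List.ofFn_succ, Fin.cons_zero,
    Fin.cons_succ, totalCost]
  calc ∑ w : Fin τ → Fin V, s (d + 1) * (∏ i, s ((w i : ℕ) + 1)) *
        (g x d + totalCost g step (t + 1) (step t x d) (List.ofFn w))
      = s (d + 1) * (g x d * ∑ w : Fin τ → Fin V, ∏ i, s ((w i : ℕ) + 1) +
          expectedCostFrom s g step (t + 1) (step t x d) τ) := by
        simp only [expectedCostFrom, mul_sum, ← sum_add_distrib]
        exact sum_congr rfl fun w _ => by ring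
    _ = s (d + 1) * (g x d + expectedCostFrom s g step (t + 1) (step t x d) τ) := by
        rw [sum_prod_eq_one h1, mul_one]

theorem totalCost_neg (w : List (Fin V)) (t : ℕ) (x : X) :
    totalCost (fun x d => -g x d) step t x w = -totalCost g step t x w := by
  induction w generalizing t x with
  | nil => simp [totalCost]
  | cons d w ih => rw [totalCost, totalCost, ih, neg_add]

theorem expectedCost_neg (x₀ : X) (τ : ℕ) :
    expectedCost s (fun x d => -g x d) step x₀ τ = -expectedCost s g step x₀ τ := by
  simp only [expectedCost, totalCost_neg, mul_neg, sum_neg_distrib]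

/-- On the invariant set `I` of states, `h` is a subsolution of the Poisson equation with
gain `G`. -/
structure IsSubsolution (s : ℕ → ℝ) (g : X → Fin V → ℝ) (step : ℕ → X → Fin V → X) (I : Set X)
    (G : ℝ) (h : X → ℝ) : Prop where
  step_mem : ∀ t, ∀ x ∈ I, ∀ d, step t x d ∈ I
  bddAbove : BddAbove (h '' I)
  le_mean : ∀ t, ∀ x ∈ I, G + h x ≤ mean s fun d => g x d + h (step t x d)

/-- On the invariant set `I` of states, `h` is a supersolution of the Poisson equation with
gain `G`. -/
structure IsSupersolution (s : ℕ → ℝ) (g : X → Fin V → ℝ) (step : ℕ → X → Fin V → X) (I : Set X)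
    (G : ℝ) (h : X → ℝ) : Prop where
  step_mem : ∀ t, ∀ x ∈ I, ∀ d, step t x d ∈ I
  bddBelow : BddBelow (h '' I)
  mean_le : ∀ t, ∀ x ∈ I, (mean s fun d => g x d + h (step t x d)) ≤ G + h x

theorem IsSupersolution.neg (hh : IsSupersolution s g step I G h) :
    IsSubsolution s (fun x d => -g x d) step I (-G) (fun x => -h x) where
  step_mem := hh.step_mem
  bddAbove := by
    obtain ⟨b, hb⟩ := hh.bddBelow
    refine ⟨-b, ?_⟩
    rintro _ ⟨x, hx, rfl⟩
    exact neg_le_neg (hb ⟨x, hx, rfl⟩)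
  le_mean t x hx := by
    have := hh.mean_le t x hx
    simp only [← neg_add, mean_neg]
    exact neg_le_neg this

theorem IsSubsolution.le_expectedCostFrom (hh : IsSubsolution s g step I G h)
    (h0 : ∀ d : Fin V, 0 ≤ s (d + 1)) (h1 : ∑ d : Fin V, s (d + 1) = 1) {B : ℝ}
    (hB : ∀ x ∈ I, h x ≤ B) (τ t : ℕ) {x : X} (hx : x ∈ I) :
    τ * G + (h x - B) ≤ expectedCostFrom s g step t x τ := by
  induction τ generalizing t x with
  | zero =>
    rw [expectedCostFrom_zero]
    simpa using hB x hx
  | succ τ ih =>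
    calc ((τ + 1 : ℕ) : ℝ) * G + (h x - B) = G + h x + (τ * G - B) := by push_cast; ring
      _ ≤ (mean s fun d => g x d + h (step t x d)) + (τ * G - B) := by
        gcongr
        exact hh.le_mean t x hx
      _ = mean s fun d => g x d + (τ * G + (h (step t x d) - B)) := by
        rw [← mean_const h1 (τ * G - B), ← mean_add]
        exact congrArg _ (funext fun d => by ring)
      _ ≤ mean s fun d => g x d + expectedCostFrom s g step (t + 1) (step t x d) τ :=
        mean_mono h0 fun d => by gcongr; exact ih (t + 1) (hh.step_mem t x hx d)
      _ = expectedCostFrom s g step t x (τ + 1) := (expectedCostFrom_succ h1 t x τ).symm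

theorem IsSubsolution.eventually_lt_expectedCost (hh : IsSubsolution s g step I G h)
    (h0 : ∀ d : Fin V, 0 ≤ s (d + 1)) (h1 : ∑ d : Fin V, s (d + 1) = 1) (hx₀ : x₀ ∈ I) {c : ℝ}
    (hc : c < G) : ∀ᶠ τ : ℕ in Filter.atTop, c < expectedCost s g step x₀ τ / τ := by
  obtain ⟨B, hB⟩ := hh.bddAbove
  obtain ⟨N, hN⟩ := exists_nat_gt ((B - h x₀) / (G - c))
  filter_upwards [Filter.eventually_gt_atTop N] with τ hτ
  have hNτ : (N : ℝ) < τ := by exact_mod_cast hτ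
  have hbound : τ * G + (h x₀ - B) ≤ expectedCost s g step x₀ τ :=
    hh.le_expectedCostFrom h0 h1 (fun x hx => hB ⟨x, hx, rfl⟩) τ 0 hx₀
  have hexcess : B - h x₀ < τ * (G - c) :=
    (div_lt_iff₀ (sub_pos.2 hc)).1 (hN.trans hNτ)
  rw [lt_div_iff₀ (N.cast_nonneg.trans_lt hNτ)]
  linarith

theorem IsSupersolution.eventually_expectedCost_lt (hh : IsSupersolution s g step I G h)
    (h0 : ∀ d : Fin V, 0 ≤ s (d + 1)) (h1 : ∑ d : Fin V, s (d + 1) = 1) (hx₀ : x₀ ∈ I) {c : ℝ}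
    (hc : G < c) : ∀ᶠ τ : ℕ in Filter.atTop, expectedCost s g step x₀ τ / τ < c := by
  filter_upwards [hh.neg.eventually_lt_expectedCost h0 h1 hx₀ (neg_lt_neg hc)] with τ hτ
  rwa [expectedCost_neg, neg_div, neg_lt_neg_iff] at hτ

end AverageCost

/-! ### The distribution of the stack distances -/

/-- `s 1 + ⋯ + s k`, the hit rate of an LRU buffer of capacity `k`. -/
noncomputable def cum (s : ℕ → ℝ) (k : ℕ) : ℝ := ∑ i ∈ range k, s (i + 1)

/-- `1 - (s 1 + ⋯ + s k)`, the miss rate of an LRU buffer of capacity `k`. -/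
noncomputable def tail (s : ℕ → ℝ) (k : ℕ) : ℝ := 1 - cum s k

theorem cum_zero (s : ℕ → ℝ) : cum s 0 = 0 := by simp [cum]

theorem cum_succ (s : ℕ → ℝ) (k : ℕ) : cum s (k + 1) = cum s k + s (k + 1) := by
  simp [cum, sum_range_succ]

theorem tail_succ (s : ℕ → ℝ) (k : ℕ) : tail s (k + 1) = tail s k - s (k + 1) := by
  rw [tail, tail, cum_succ, sub_sub]

section Distribution

variable {V : ℕ} {s : ℕ → ℝ}

theorem IsStackDistribution.cum_last (hs : IsStackDistribution V s) : cum s V = 1 := by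
  rw [← hs.sum_eq_one, cum, range_eq_Ico, sum_Ico_add' s 0 V 1]
  rfl

theorem IsStackDistribution.sum_fin (hs : IsStackDistribution V s) :
    ∑ d : Fin V, s (d + 1) = 1 := by
  rw [Fin.sum_univ_eq_sum_range (fun i => s (i + 1)) V]
  exact hs.cum_last

theorem IsStackDistribution.nonneg_fin (hs : IsStackDistribution V s) (d : Fin V) :
    0 ≤ s (d + 1) :=
  hs.nonneg _ (by omega) (by omega)

theorem IsStackDistribution.cum_mono (hs : IsStackDistribution V s) {a b : ℕ} (hab : a ≤ b)
    (hb : b ≤ V) : cum s a ≤ cum s b :=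
  sum_le_sum_of_subset_of_nonneg (range_mono hab) fun i hi _ =>
    hs.nonneg _ (by omega) (by rw [mem_range] at hi; omega)

theorem IsStackDistribution.one_le (hs : IsStackDistribution V s) : 1 ≤ V := by
  rcases V.eq_zero_or_pos with rfl | hV
  · simpa using hs.sum_eq_one
  · exact hV

theorem IsStackDistribution.cast_pos (hs : IsStackDistribution V s) : (0 : ℝ) < V :=
  Nat.cast_pos.2 hs.one_le

theorem IsStackDistribution.last_pos (hs : IsStackDistribution V s) : 0 < s V :=
  (hs.nonneg V hs.one_le le_rfl).lt_of_ne' hs.last_ne_zero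

theorem IsStackDistribution.cum_lt_one (hs : IsStackDistribution V s) {k : ℕ} (hk : k < V) :
    cum s k < 1 := by
  obtain ⟨n, rfl⟩ := Nat.exists_eq_add_one_of_ne_zero (Nat.ne_zero_of_lt hk)
  calc cum s k ≤ cum s n := hs.cum_mono (by omega) (by omega)
    _ < cum s n + s (n + 1) := lt_add_of_pos_right _ hs.last_pos
    _ = 1 := by rw [← cum_succ, hs.cum_last]

theorem IsStackDistribution.tail_pos (hs : IsStackDistribution V s) {k : ℕ} (hk : k < V) :
    0 < tail s k :=
  sub_pos.2 (hs.cum_lt_one hk)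

theorem IsStackDistribution.tail_last (hs : IsStackDistribution V s) : tail s V = 0 := by
  rw [tail, hs.cum_last, sub_self]

end Distribution

/-! ### The motion of one item in the stack -/

section Motion

variable {V : ℕ} {s : ℕ → ℝ}

theorem coe_cycleRange (d z : Fin V) :
    (Fin.cycleRange d z : ℕ) = if z < d then (z : ℕ) + 1 else if z = d then 0 else z := by
  split_ifs with hlt heq
  · exact Fin.coe_cycleRange_of_lt hlt
  · subst heq
    have : NeZero V := ⟨fun hV => by subst hV; exact z.elim0⟩
    simp
  · rw [Fin.cycleRange_of_gt (lt_of_le_of_ne (not_lt.1 hlt) (Ne.symm heq))]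

theorem coe_cycleRange_self (d : Fin V) : (Fin.cycleRange d d : ℕ) = 0 := by
  simp [coe_cycleRange]

theorem le_coe_cycleRange {d z : Fin V} (h : d ≠ z) : (z : ℕ) ≤ Fin.cycleRange d z := by
  rw [coe_cycleRange, if_neg h.symm]
  split_ifs <;> omega

theorem coe_cycleRange_le (d z : Fin V) : (Fin.cycleRange d z : ℕ) ≤ z + 1 := by
  rw [coe_cycleRange]
  split_ifs <;> omega

theorem one_le_coe_cycleRange {d z : Fin V} (h : d ≠ z) : 1 ≤ (Fin.cycleRange d z : ℕ) := by
  rw [coe_cycleRange, if_neg h.symm]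
  split_ifs <;> omega

/-- The item at position `z` stays for `d < z`, is accessed for `d = z`, and goes down for
`z < d`. -/
theorem mean_eq_of_trichotomy (hs : IsStackDistribution V s) {f : Fin V → ℝ} {z : Fin V}
    {a b : ℝ} (ha : ∀ d < z, f d = a) (hb : ∀ d, z < d → f d = b) :
    mean s f = cum s z * a + s (z + 1) * f z + tail s (z + 1) * b := by
  let F : ℕ → ℝ := fun i => s (i + 1) * if i < z then a else if i = z then f z else b
  have hF : ∀ d : Fin V, s (d + 1) * f d = F d := by
    intro d
    rcases lt_trichotomy d z with hd | rfl | hd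
    · simp [F, hd, ha d hd]
    · simp [F]
    · simp [F, hd.not_gt, Fin.val_inj, hd.ne', hb d hd]
  have hstay : ∑ i ∈ range z, F i = cum s z * a := by
    rw [cum, sum_mul]
    exact sum_congr rfl fun i hi => by simp [F, mem_range.1 hi]
  have hdown : ∑ i ∈ Ico ((z : ℕ) + 1) V, F i = tail s (z + 1) * b := by
    rw [tail, ← hs.cum_last, cum, cum, ← sum_Ico_eq_sub _ z.is_lt, sum_mul]
    refine sum_congr rfl fun i hi => ?_
    have : (z : ℕ) < i := (mem_Ico.1 hi).1
    simp [F, this.not_gt, this.ne']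
  calc mean s f = ∑ i ∈ range V, F i := by
        rw [mean, sum_congr rfl fun d _ => hF d, Fin.sum_univ_eq_sum_range F]
    _ = cum s z * a + F z + tail s (z + 1) * b := by
        rw [← sum_range_add_sum_Ico F z.is_lt, sum_range_succ, hstay, hdown]
    _ = _ := by simp [F]

theorem mean_cycleRange (hs : IsStackDistribution V s) (φ : ℕ → ℝ) (z : Fin V) :
    mean s (fun d => φ (Fin.cycleRange d z)) =
      cum s z * φ z + s (z + 1) * φ 0 + tail s (z + 1) * φ (z + 1) := by
  rw [← coe_cycleRange_self z]
  exact mean_eq_of_trichotomy hs (fun d hd => by rw [Fin.cycleRange_of_gt hd])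
    fun d hd => by rw [Fin.coe_cycleRange_of_lt hd]

/-- Potentials of the form `a / tail s` turn the motion of an item between two accesses into a
telescoping sum: this is what solves all the Poisson equations below. -/
theorem cum_mul_div_tail_add (hs : IsStackDistribution V s) (a : ℕ → ℝ) {z : ℕ} (hz : z < V) :
    cum s z * (a z / tail s z) + tail s (z + 1) * (a (z + 1) / tail s (z + 1)) =
      a z / tail s z - a z + if z + 1 < V then a (z + 1) else 0 := by
  have hstay : cum s z * (a z / tail s z) = a z / tail s z - a z := by
    rw [show cum s z = 1 - tail s z from (sub_sub_cancel 1 _).symm, sub_mul, one_mul,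
      mul_div_cancel₀ _ (hs.tail_pos hz).ne']
  rw [hstay]
  split_ifs with hz'
  · rw [mul_div_cancel₀ _ (hs.tail_pos hz').ne']
  · rw [show z + 1 = V by omega, hs.tail_last, zero_mul]

theorem cum_mul_div_tail_add_of_last_eq_zero (hs : IsStackDistribution V s) {a : ℕ → ℝ}
    (ha : a V = 0) {z : ℕ} (hz : z < V) :
    cum s z * (a z / tail s z) + tail s (z + 1) * (a (z + 1) / tail s (z + 1)) =
      a z / tail s z - a z + a (z + 1) := by
  rw [cum_mul_div_tail_add hs a hz]
  split_ifs with hz'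
  · rfl
  · rw [show z + 1 = V by omega, ha]

end Motion

/-! ### The cost points of the single-item policies -/

section SingleItem

variable {V : ℕ} {s : ℕ → ℝ}

theorem sum_range_ite_lt_one {k : ℕ} (hk : k ≤ V) :
    ∑ z ∈ range V, (if z < k then (1 : ℝ) else 0) = k := by
  rw [sum_boole, show {z ∈ range V | z < k} = range k by ext; simp; omega, card_range]

theorem IsStackDistribution.sum_range_ite_lt (hs : IsStackDistribution V s) {k : ℕ} (hk : k ≤ V) :
    ∑ z ∈ range V, (if z < k then 0 else s (z + 1)) = tail s k := by
  rw [← sum_range_add_sum_Ico _ hk, sum_eq_zero fun z hz => if_pos (mem_range.1 hz), zero_add,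
    sum_congr rfl fun z hz => if_neg (mem_Ico.1 hz).1.not_gt, sum_Ico_eq_sub _ hk, tail,
    ← hs.cum_last, cum, cum]

theorem itemStep_snd_eq_decide {e : Fin V → Bool} {k : ℕ} (hk : 1 ≤ k)
    (hkeep : ∀ z : Fin V, 1 ≤ (z : ℕ) → (z : ℕ) < k → e z = false)
    (hevict : ∀ z : Fin V, (z : ℕ) = k → e z = true) (t : ℕ) {x : ItemState V}
    (hx : x.2 = decide ((x.1 : ℕ) < k)) (d : Fin V) :
    (itemStep e t x d).2 = decide (((itemStep e t x d).1 : ℕ) < k) := by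
  obtain ⟨z, b⟩ := x
  obtain rfl : b = decide ((z : ℕ) < k) := hx
  simp only [itemStep]
  split_ifs with hd
  · rw [hd, coe_cycleRange_self, decide_eq_true (by omega)]
  · have hle := le_coe_cycleRange hd
    have hsucc := coe_cycleRange_le d z
    have hpos := one_le_coe_cycleRange hd
    rcases lt_trichotomy (Fin.cycleRange d z : ℕ) k with hk' | hk' | hk'
    · rw [hkeep _ hpos hk', decide_eq_true hk', decide_eq_true (by omega)]
      rfl
    · rw [hevict _ hk', decide_eq_false hk'.not_lt, Bool.not_true, Bool.and_false]
    · rw [decide_eq_false (by omega : ¬(z : ℕ) < k), decide_eq_false hk'.not_gt, Bool.false_and]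

/-- The cost point of the policy `ev_k`. -/
noncomputable def evPoint (V : ℕ) (s : ℕ → ℝ) (k : ℕ) : ℝ × ℝ := (k / V, tail s k / V)

theorem exists_first_eviction (hV : 1 ≤ V) (e : Fin V → Bool) :
    ∃ k, 1 ≤ k ∧ k ≤ V ∧ (∀ z : Fin V, 1 ≤ (z : ℕ) → (z : ℕ) < k → e z = false) ∧
      ∀ z : Fin V, (z : ℕ) = k → e z = true := by
  classical
  have hex : ∃ k, 1 ≤ k ∧ ∀ z : Fin V, (z : ℕ) = k → e z = true :=
    ⟨V, hV, fun z hz => absurd hz z.is_lt.ne⟩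
  refine ⟨Nat.find hex, (Nat.find_spec hex).1,
    Nat.find_min' hex ⟨hV, fun z hz => absurd hz z.is_lt.ne⟩, fun z hz hlt => ?_,
    (Nat.find_spec hex).2⟩
  by_contra hne
  exact Nat.find_min hex hlt ⟨hz, fun y hy => by simpa [Fin.ext hy] using hne⟩

theorem evPoint_injective (hs : IsStackDistribution V s) : Function.Injective (evPoint V s) :=
  fun _ _ h => Nat.cast_injective ((div_left_inj' hs.cast_pos.ne').1 (congrArg Prod.fst h))

/-- The miss rate plus the occupancy at the price `r`. -/
noncomputable def pricedCost (r : ℝ) : ℝ × ℝ →ₗ[ℝ] ℝ :=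
  LinearMap.snd ℝ ℝ ℝ + r • LinearMap.fst ℝ ℝ ℝ

theorem pricedCost_apply (r : ℝ) (p : ℝ × ℝ) : pricedCost r p = p.2 + r * p.1 := rfl

theorem pricedCost_evPoint (s : ℕ → ℝ) (r : ℝ) (k : ℕ) :
    pricedCost r (evPoint V s k) = (tail s k + r * k) / V := by
  rw [pricedCost_apply, evPoint, add_div, mul_div_assoc]

theorem mk_mem_segment_evPoint {K L : ℕ} {k r w : ℝ} (hKk : K ≤ k) (hkL : k ≤ L)
    (hK : tail s K + r * K = w) (hL : tail s L + r * L = w) :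
    (k / V, (w - r * k) / V) ∈ segment ℝ (evPoint V s K) (evPoint V s L) := by
  obtain ⟨a, b, ha, hb, hab, hk⟩ := Icc_subset_segment (𝕜 := ℝ) ⟨hKk, hkL⟩
  refine ⟨a, b, ha, hb, hab, ?_⟩
  rw [smul_eq_mul, smul_eq_mul] at hk
  have htail : a * tail s K + b * tail s L = w - r * k := by
    rw [eq_sub_of_add_eq hK, eq_sub_of_add_eq hL, ← hk]
    linear_combination w * hab
  simp only [evPoint, Prod.smul_mk, Prod.mk_add_mk, smul_eq_mul, ← mul_div_assoc, ← add_div, hk,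
    htail]

variable [NeZero V]

theorem hasAverageCost_itemStep (hs : IsStackDistribution V s) {e : Fin V → Bool}
    {I : Set (ItemState V)} (hI : ∀ t, ∀ x ∈ I, ∀ d, itemStep e t x d ∈ I) (h0 : (0, true) ∈ I)
    {g : ItemState V → Fin V → ℝ} {f : ℕ → ℝ} (hf : ∀ x ∈ I, mean s (g x) = f x.1) :
    HasAverageCost s g (itemStep e) (0, true) ((∑ z ∈ range V, f z) / V) := by
  set G := (∑ z ∈ range V, f z) / V with hG
  let a : ℕ → ℝ := fun z => z * G - ∑ y ∈ range z, f y
  let h : ItemState V → ℝ := fun x => a x.1 / tail s x.1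
  have ha0 : a 0 = 0 := by simp [a]
  have haV : a V = 0 := by
    rw [sub_eq_zero, hG, mul_div_cancel₀ _ hs.cast_pos.ne']
  have poisson : ∀ t, ∀ x ∈ I, (mean s fun d => g x d + h (itemStep e t x d)) = G + h x := by
    intro t x hx
    have hstep : a (x.1 + 1) = a x.1 + G - f x.1 := by
      simp only [a, sum_range_succ, Nat.cast_add_one]
      ring
    have hmotion := mean_cycleRange hs (fun z => a z / tail s z) x.1
    have htelescope := cum_mul_div_tail_add_of_last_eq_zero hs haV x.1.is_lt
    rw [ha0, zero_div, mul_zero, add_zero] at hmotion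
    rw [mean_add, hf x hx]
    simp only [h, itemStep]
    linarith
  have hsub : IsSubsolution s g (itemStep e) I G h :=
    ⟨hI, (Set.toFinite _).bddAbove, fun t x hx => (poisson t x hx).ge⟩
  have hsuper : IsSupersolution s g (itemStep e) I G h :=
    ⟨hI, (Set.toFinite _).bddBelow, fun t x hx => (poisson t x hx).le⟩
  exact tendsto_order.2
    ⟨fun _ => hsub.eventually_lt_expectedCost hs.nonneg_fin hs.sum_fin h0,
      fun _ => hsuper.eventually_expectedCost_lt hs.nonneg_fin hs.sum_fin h0⟩

theorem hasItemCosts_of_first_eviction (hs : IsStackDistribution V s) {e : Fin V → Bool} {k : ℕ}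
    (hk : 1 ≤ k) (hkV : k ≤ V) (hkeep : ∀ z : Fin V, 1 ≤ (z : ℕ) → (z : ℕ) < k → e z = false)
    (hevict : ∀ z : Fin V, (z : ℕ) = k → e z = true) :
    HasItemCosts s e (evPoint V s k) := by
  let I : Set (ItemState V) := {x | x.2 = decide ((x.1 : ℕ) < k)}
  have hI : ∀ t, ∀ x ∈ I, ∀ d, itemStep e t x d ∈ I := fun t _ hx d =>
    itemStep_snd_eq_decide hk hkeep hevict t hx d
  have h0 : ((0, true) : ItemState V) ∈ I := (decide_eq_true hk).symm
  have hoccupancy : ∀ x ∈ I, mean s (itemOccupancy x) = if (x.1 : ℕ) < k then 1 else 0 := by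
    intro x (hx : x.2 = _)
    rw [← mean_const hs.sum_fin (if (x.1 : ℕ) < k then (1 : ℝ) else 0)]
    exact congrArg _ (funext fun d => by simp [itemOccupancy, hx])
  have hmiss : ∀ x ∈ I, mean s (itemMiss x) = if (x.1 : ℕ) < k then 0 else s (x.1 + 1) := by
    intro x (hx : x.2 = _)
    by_cases hz : (x.1 : ℕ) < k <;> simp [mean, itemMiss, hx, hz]
  constructor
  · rw [evPoint, ← sum_range_ite_lt_one hkV]
    exact hasAverageCost_itemStep hs hI h0 hoccupancy
  · rw [evPoint, ← hs.sum_range_ite_lt hkV]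
    exact hasAverageCost_itemStep hs hI h0 hmiss

theorem hasItemCosts_evPolicy (hs : IsStackDistribution V s) {k : ℕ} (hk : 1 ≤ k) (hkV : k ≤ V) :
    HasItemCosts (V := V) s (evPolicy k) (evPoint V s k) :=
  hasItemCosts_of_first_eviction hs hk hkV (fun z _ h => by simp [evPolicy]; omega)
    fun z h => by simp [evPolicy]; omega

theorem HasItemCosts.unique {e : Fin V → Bool} {p p' : ℝ × ℝ} (h : HasItemCosts s e p)
    (h' : HasItemCosts s e p') : p = p' :=
  Prod.ext (tendsto_nhds_unique h.1 h'.1) (tendsto_nhds_unique h.2 h'.2)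

theorem itemCostPoints_eq_image (hs : IsStackDistribution V s) :
    itemCostPoints V s = evPoint V s '' Set.Icc 1 V := by
  ext p
  constructor
  · rintro ⟨e, he⟩
    obtain ⟨k, hk, hkV, hkeep, hevict⟩ := exists_first_eviction hs.one_le e
    exact ⟨k, ⟨hk, hkV⟩, (hasItemCosts_of_first_eviction hs hk hkV hkeep hevict).unique he⟩
  · rintro ⟨k, ⟨hk, hkV⟩, rfl⟩
    exact ⟨_, hasItemCosts_evPolicy hs hk hkV⟩

theorem evPoint_mem (hs : IsStackDistribution V s) {k : ℕ} (hk : 1 ≤ k) (hkV : k ≤ V) :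
    evPoint V s k ∈ itemCostPoints V s :=
  ⟨_, hasItemCosts_evPolicy hs hk hkV⟩

theorem isSupportedEv_of_lt (hs : IsStackDistribution V s) {k : ℕ} (hk : 1 ≤ k) (hkV : k ≤ V)
    {r : ℝ} (hr : 0 ≤ r)
    (h : ∀ z, 1 ≤ z → z ≤ V → z ≠ k → tail s k + r * k < tail s z + r * z) :
    IsSupportedEv V s k := by
  refine ⟨_, hasItemCosts_evPolicy hs hk hkV, ?_⟩
  rintro ⟨y, hy, hle⟩
  have hothers : itemCostPoints V s \ {evPoint V s k} ⊆
      {p | pricedCost r (evPoint V s k) < pricedCost r p} := by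
    rw [itemCostPoints_eq_image hs]
    rintro _ ⟨⟨z, ⟨hz, hzV⟩, rfl⟩, hne⟩
    have hzk : z ≠ k := fun hzk => hne (congrArg _ hzk)
    rw [Set.mem_ofPred_eq, pricedCost_evPoint, pricedCost_evPoint]
    exact div_lt_div_of_pos_right (h z hz hzV hzk) hs.cast_pos
  have hlt : pricedCost r (evPoint V s k) < pricedCost r y :=
    convexHull_min hothers (convex_halfSpace_gt (pricedCost r).isLinear _) hy
  exact hlt.not_ge (add_le_add hle.2 (mul_le_mul_of_nonneg_left hle.1 hr))

theorem not_isSupportedEv_of_le (hs : IsStackDistribution V s) {K k L : ℕ} (hK : 1 ≤ K)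
    (hKk : K < k) (hkL : k < L) (hLV : L ≤ V) {r w : ℝ} (hKw : tail s K + r * K = w)
    (hLw : tail s L + r * L = w) (hkw : w ≤ tail s k + r * k) : ¬IsSupportedEv V s k := by
  rintro ⟨p, hp, hefficient⟩
  obtain rfl := hp.unique (hasItemCosts_evPolicy hs (by omega) (by omega))
  have hmem : ∀ z, 1 ≤ z → z ≤ V → z ≠ k →
      evPoint V s z ∈ itemCostPoints V s \ {evPoint V s k} := fun z hz hzV hzk =>
    ⟨evPoint_mem hs hz hzV, fun h => hzk (evPoint_injective hs h)⟩
  refine hefficient ⟨(k / V, (w - r * k) / V), ?_, le_rfl, ?_⟩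
  · exact segment_subset_convexHull (hmem K hK (by omega) hKk.ne)
      (hmem L (by omega) hLV hkL.ne')
      (mk_mem_segment_evPoint (mod_cast hKk.le) (mod_cast hkL.le) hKw hLw)
  · exact div_le_div_of_nonneg_right (by linarith) hs.cast_pos.le

/-- The Lagrange multiplier `r` of the average occupancy constraint, for capacities in
`(K, L]`: the priced cost `tail s z + r * z` is at least `w`, with equality at `K` and `L`. The
segment from `0` to `1` stands for the capacity `1`, where only `L` has to be tight. -/
structure IsSupportingSegment (V : ℕ) (s : ℕ → ℝ) (K L : ℕ) (r w : ℝ) : Prop where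
  nonneg : 0 ≤ r
  le : ∀ z, 1 ≤ z → z ≤ V → w ≤ tail s z + r * z
  left : 1 ≤ K → tail s K + r * K = w
  right : tail s L + r * L = w
  le_last : L ≤ V
  right_eq_one : K = 0 → L = 1

variable {K C L : ℕ} {r w : ℝ}

theorem IsSupportingSegment.mk_mem_convexHull (h : IsSupportingSegment V s K L r w)
    (hs : IsStackDistribution V s) (hKC : K < C) (hCL : C ≤ L) :
    ((C : ℝ) / V, (w - r * C) / V) ∈ convexHull ℝ (itemCostPoints V s) := by
  have hL := evPoint_mem hs (by omega) h.le_last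
  rcases K.eq_zero_or_pos with hK | hK
  · have hLC : L = C := by have := h.right_eq_one hK; omega
    exact segment_subset_convexHull hL hL
      (mk_mem_segment_evPoint (mod_cast hLC.le) (mod_cast hCL) h.right h.right)
  · have hLV := h.le_last
    exact segment_subset_convexHull (evPoint_mem hs hK (by omega)) hL
      (mk_mem_segment_evPoint (mod_cast hKC.le) (mod_cast hCL) (h.left hK) h.right)

theorem IsSupportingSegment.isAverageOccupancyOptimum (h : IsSupportingSegment V s K L r w)
    (hs : IsStackDistribution V s) (hKC : K < C) (hCL : C ≤ L) :
    IsAverageOccupancyOptimum V s C (w - r * C) := by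
  have hV := hs.cast_pos.ne'
  refine ⟨⟨_, h.mk_mem_convexHull hs hKC hCL, mul_div_cancel₀ _ hV, mul_div_cancel₀ _ hV⟩, ?_⟩
  rintro _ ⟨p, hp, hC, rfl⟩
  have hle : itemCostPoints V s ⊆ {p | w / V ≤ pricedCost r p} := by
    rw [itemCostPoints_eq_image hs]
    rintro _ ⟨z, ⟨hz, hzV⟩, rfl⟩
    rw [Set.mem_ofPred_eq, pricedCost_evPoint]
    exact div_le_div_of_nonneg_right (h.le z hz hzV) hs.cast_pos.le
  have hwp : w / V ≤ p.2 + r * p.1 :=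
    convexHull_min hle (convex_halfSpace_ge (pricedCost r).isLinear _) hp
  rw [div_le_iff₀ hs.cast_pos] at hwp
  rw [← hC]
  linarith

end SingleItem

/-! ### The concave hull of the cumulated distribution -/

/-- The average of `s (m + 1), …, s e`, which is the slope of the chord of `cum s` from `m`
to `e`. -/
noncomputable def chordSlope (s : ℕ → ℝ) (m e : ℕ) : ℝ := (cum s e - cum s m) / ((e : ℝ) - m)

/-- Among the chords from `m` to `m + 1, …, e`, the last one is the steepest. -/
structure IsPrefixMax (V : ℕ) (s : ℕ → ℝ) (m e : ℕ) : Prop where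
  lt : m < e
  le_last : e ≤ V
  slope_le : ∀ n, m < n → n ≤ e → chordSlope s m n ≤ chordSlope s m e

/-- The right neighbour `e` of the vertex `m` on the concave hull of `cum s` on `[m, V]`: the last
end of a steepest chord from `m`. -/
structure IsNextVertex (V : ℕ) (s : ℕ → ℝ) (m e : ℕ) : Prop extends IsPrefixMax V s m e where
  slope_lt : ∀ n, e < n → n ≤ V → chordSlope s m n < chordSlope s m e

/-- The list of the vertices to the right of `m` of the concave hull of `cum s` on `[m, V]`. -/
inductive HullChain (V : ℕ) (s : ℕ → ℝ) : ℕ → List ℕ → Prop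
  | last : HullChain V s V []
  | cons {m e : ℕ} {l : List ℕ} :
      IsNextVertex V s m e → HullChain V s e l → HullChain V s m (e :: l)

/-- A line of slope `r > 0` through `m` lies weakly above `cum s` on the left of `m` and strictly
above it on the right: `m` is then a vertex of the concave hull. -/
structure IsVertexSlope (V : ℕ) (s : ℕ → ℝ) (m : ℕ) (r : ℝ) : Prop where
  one_le : 1 ≤ m
  le_last : m ≤ V
  pos : 0 < r
  le_slope : ∀ z, 1 ≤ z → z < m → r ≤ chordSlope s z m
  slope_lt : ∀ z, m < z → z ≤ V → chordSlope s m z < r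

section Hull

variable {V m e f : ℕ} {s : ℕ → ℝ} {l : List ℕ} {r : ℝ}

theorem chordSlope_mul (h : m < e) : chordSlope s m e * ((e : ℝ) - m) = cum s e - cum s m :=
  div_mul_cancel₀ _ (sub_pos.2 (Nat.cast_lt.2 h)).ne'

theorem chordSlope_le_iff (h : m < e) :
    chordSlope s m e ≤ r ↔ cum s e ≤ cum s m + r * ((e : ℝ) - m) := by
  rw [chordSlope, div_le_iff₀ (sub_pos.2 (Nat.cast_lt.2 h)), sub_le_iff_le_add']

theorem chordSlope_lt_iff (h : m < e) :
    chordSlope s m e < r ↔ cum s e < cum s m + r * ((e : ℝ) - m) := by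
  rw [chordSlope, div_lt_iff₀ (sub_pos.2 (Nat.cast_lt.2 h)), sub_lt_iff_lt_add']

theorem le_chordSlope_iff (h : m < e) :
    r ≤ chordSlope s m e ↔ cum s m ≤ cum s e + r * ((m : ℝ) - e) := by
  rw [chordSlope, le_div_iff₀ (sub_pos.2 (Nat.cast_lt.2 h)), ← neg_sub (m : ℝ), mul_neg,
    le_sub_iff_add_le, neg_add_le_iff_le_add, add_comm]

theorem lt_chordSlope_iff (h : m < e) :
    r < chordSlope s m e ↔ cum s m < cum s e + r * ((m : ℝ) - e) := by
  rw [chordSlope, lt_div_iff₀ (sub_pos.2 (Nat.cast_lt.2 h)), ← neg_sub (m : ℝ), mul_neg,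
    lt_sub_iff_add_lt, neg_add_lt_iff_lt_add, add_comm]

theorem isPrefixMax_succ (h : m < V) : IsPrefixMax V s m (m + 1) where
  lt := m.lt_succ_self
  le_last := h
  slope_le n hmn hn := by rw [show n = m + 1 by omega]

theorem chordSlope_le_of_le (hme : m < e) (hef : e < f)
    (hle : chordSlope s m e ≤ chordSlope s e f) : chordSlope s m e ≤ chordSlope s m f := by
  have hef' : (0 : ℝ) ≤ f - e := sub_nonneg.2 (mod_cast hef.le)
  rw [le_chordSlope_iff (hme.trans hef)]
  have := chordSlope_mul (s := s) hme
  have := chordSlope_mul (s := s) hef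
  have := mul_le_mul_of_nonneg_right hle hef'
  linarith

theorem le_chordSlope_of_le (hme : m < e) (hef : e < f)
    (hle : chordSlope s m e ≤ chordSlope s e f) : chordSlope s m f ≤ chordSlope s e f := by
  have hme' : (0 : ℝ) ≤ e - m := sub_nonneg.2 (mod_cast hme.le)
  rw [chordSlope_le_iff (hme.trans hef)]
  have := chordSlope_mul (s := s) hme
  have := chordSlope_mul (s := s) hef
  have := mul_le_mul_of_nonneg_right hle hme'
  linarith

theorem IsNextVertex.slope_le_of_le_last (h : IsNextVertex V s m e) {n : ℕ} (hmn : m < n)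
    (hn : n ≤ V) : chordSlope s m n ≤ chordSlope s m e :=
  (le_or_gt n e).elim (h.slope_le n hmn) fun hen => (h.slope_lt n hen hn).le

theorem IsPrefixMax.merge (h : IsPrefixMax V s m e) (hf : IsNextVertex V s e f)
    (hle : chordSlope s m e ≤ chordSlope s e f) : IsPrefixMax V s m f where
  lt := h.lt.trans hf.lt
  le_last := hf.le_last
  slope_le n hmn hnf := by
    rcases le_or_gt n e with hne | hen
    · exact (h.slope_le n hmn hne).trans (chordSlope_le_of_le h.lt hf.lt hle)
    · have hnf' : (0 : ℝ) ≤ f - n := sub_nonneg.2 (mod_cast hnf)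
      rw [chordSlope_le_iff hmn]
      calc cum s n ≤ cum s e + chordSlope s e f * (n - e) :=
            (chordSlope_le_iff hen).1 (hf.slope_le n hen hnf)
        _ = cum s f - chordSlope s e f * (f - n) := by
            linear_combination chordSlope_mul (s := s) hf.lt
        _ ≤ cum s f - chordSlope s m f * (f - n) :=
            sub_le_sub_left
              (mul_le_mul_of_nonneg_right (le_chordSlope_of_le h.lt hf.lt hle) hnf') _
        _ = cum s m + chordSlope s m f * (n - m) := by
            linear_combination -chordSlope_mul (s := s) (h.lt.trans hf.lt)

theorem IsPrefixMax.isNextVertex_of_lt (h : IsPrefixMax V s m e) (hf : IsNextVertex V s e f)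
    (hlt : chordSlope s e f < chordSlope s m e) : IsNextVertex V s m e where
  toIsPrefixMax := h
  slope_lt n hen hn := by
    rw [chordSlope_lt_iff (h.lt.trans hen)]
    calc cum s n < cum s e + chordSlope s m e * (n - e) :=
          (chordSlope_lt_iff hen).1 ((hf.slope_le_of_le_last hen hn).trans_lt hlt)
      _ = cum s m + chordSlope s m e * (n - m) := by
          linear_combination -chordSlope_mul (s := s) h.lt

theorem IsPrefixMax.isNextVertex_last (h : IsPrefixMax V s m V) : IsNextVertex V s m V where
  toIsPrefixMax := h
  slope_lt _ hVn hn := absurd hn hVn.not_ge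

theorem IsPrefixMax.exists_isNextVertex (h : IsPrefixMax V s m e) (hl : HullChain V s e l) :
    ∃ e' l', IsNextVertex V s m e' ∧ HullChain V s e' l' := by
  induction hl with
  | last => exact ⟨V, [], h.isNextVertex_last, .last⟩
  | @cons e f l hf hl ih =>
    rcases le_or_gt (chordSlope s m e) (chordSlope s e f) with hle | hlt
    · exact ih (h.merge hf hle)
    · exact ⟨e, f :: l, h.isNextVertex_of_lt hf hlt, .cons hf hl⟩

theorem exists_hullChain (s : ℕ → ℝ) (hm : m ≤ V) : ∃ l, HullChain V s m l := by
  induction hm using Nat.decreasingInduction with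
  | self => exact ⟨[], .last⟩
  | of_succ m hm ih =>
    obtain ⟨l, hl⟩ := ih
    obtain ⟨e, l', he, hl'⟩ := (isPrefixMax_succ hm).exists_isNextVertex hl
    exact ⟨e :: l', .cons he hl'⟩

theorem IsNextVertex.unique (he : IsNextVertex V s m e) (hf : IsNextVertex V s m f) : e = f := by
  rcases lt_trichotomy e f with h | h | h
  · exact absurd (hf.slope_le e he.lt h.le) (he.slope_lt f h hf.le_last).not_ge
  · exact h
  · exact absurd (he.slope_le f hf.lt h.le) (hf.slope_lt e h he.le_last).not_ge

theorem IsNextVertex.lt_last (h : IsNextVertex V s m e) : m < V := h.lt.trans_le h.le_last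

theorem HullChain.unique {l' : List ℕ} (h : HullChain V s m l) (h' : HullChain V s m l') :
    l = l' := by
  induction h generalizing l' with
  | last =>
    cases h' with
    | last => rfl
    | cons he _ => exact absurd he.lt_last (lt_irrefl _)
  | cons he _ ih =>
    cases h' with
    | last => exact absurd he.lt_last (lt_irrefl _)
    | cons he' hl' =>
      obtain rfl := he.unique he'
      rw [ih hl']

theorem HullChain.mem_Icc (h : HullChain V s m l) : ∀ k ∈ m :: l, m ≤ k ∧ k ≤ V := by
  induction h with
  | last => simp
  | cons he _ ih =>
    intro k hk
    rcases List.mem_cons.1 hk with rfl | hk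
    · exact ⟨le_rfl, he.lt_last.le⟩
    · exact ⟨he.lt.le.trans (ih k hk).1, (ih k hk).2⟩

theorem HullChain.pairwise (h : HullChain V s m l) : (m :: l).Pairwise (· < ·) := by
  induction h with
  | last => simp
  | cons he hl ih =>
    exact List.pairwise_cons.2 ⟨fun k hk => he.lt.trans_le (hl.mem_Icc k hk).1, ih⟩

theorem HullChain.getLast?_cons (h : HullChain V s m l) : (m :: l).getLast? = some V := by
  induction h with
  | last => rfl
  | cons he hl ih => rw [List.getLast?_cons_cons, ih]

theorem IsNextVertex.slope_pos (hs : IsStackDistribution V s) (h : IsNextVertex V s m e) :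
    0 < chordSlope s m e := by
  have hmV := h.lt_last
  have hlast : 0 < chordSlope s m V :=
    div_pos (by rw [hs.cum_last]; exact hs.tail_pos hmV) (sub_pos.2 (Nat.cast_lt.2 hmV))
  exact hlast.trans_le (h.slope_le_of_le_last hmV le_rfl)

theorem isVertexSlope_one (hs : IsStackDistribution V s) : IsVertexSlope V s 1 2 where
  one_le := le_rfl
  le_last := hs.one_le
  pos := two_pos
  le_slope z hz hz' := absurd hz' hz.not_gt
  slope_lt z hz hzV := by
    have hle : cum s z ≤ 1 := hs.cum_last ▸ hs.cum_mono hzV le_rfl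
    have hnonneg : 0 ≤ cum s 1 := cum_zero s ▸ hs.cum_mono zero_le_one hs.one_le
    have hz' : (2 : ℝ) ≤ z := mod_cast hz
    rw [chordSlope_lt_iff hz]
    push_cast
    linarith

theorem IsVertexSlope.cum_le (h : IsVertexSlope V s m r) (he : IsNextVertex V s m e) {z : ℕ}
    (hz : 1 ≤ z) (hzV : z ≤ V) : cum s z ≤ cum s m + chordSlope s m e * (z - m) := by
  rcases lt_trichotomy z m with hzm | rfl | hmz
  · exact (le_chordSlope_iff hzm).1
      ((h.slope_lt e he.lt he.le_last).le.trans (h.le_slope z hz hzm))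
  · simp
  · exact (chordSlope_le_iff hmz).1 (he.slope_le_of_le_last hmz hzV)

theorem IsVertexSlope.next (hs : IsStackDistribution V s) (h : IsVertexSlope V s m r)
    (he : IsNextVertex V s m e) : IsVertexSlope V s e (chordSlope s m e) where
  one_le := h.one_le.trans he.lt.le
  le_last := he.le_last
  pos := he.slope_pos hs
  le_slope z hz hze := by
    rw [le_chordSlope_iff hze]
    have := h.cum_le he hz (hze.le.trans he.le_last)
    have := chordSlope_mul (s := s) he.lt
    linarith
  slope_lt z hez hzV := by
    rw [chordSlope_lt_iff hez]
    have := (chordSlope_lt_iff (he.lt.trans hez)).1 (he.slope_lt z hez hzV)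
    have := chordSlope_mul (s := s) he.lt
    linarith

theorem IsVertexSlope.isSupportedEv [NeZero V] (hs : IsStackDistribution V s)
    (h : IsVertexSlope V s m r) (hl : HullChain V s m l) : IsSupportedEv V s m := by
  obtain ⟨r', hr'0, hr', hright⟩ : ∃ r', 0 ≤ r' ∧ r' < r ∧
      ∀ z, m < z → z ≤ V → chordSlope s m z ≤ r' := by
    cases hl with
    | last => exact ⟨0, le_rfl, h.pos, fun z hVz hzV => absurd hzV hVz.not_ge⟩
    | cons he _ =>
      exact ⟨_, (he.slope_pos hs).le, h.slope_lt _ he.lt he.le_last,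
        fun _ => he.slope_le_of_le_last⟩
  obtain ⟨ρ, hr'ρ, hρr⟩ := exists_between hr'
  refine isSupportedEv_of_lt hs h.one_le h.le_last (hr'0.trans hr'ρ.le) fun z hz hzV hne => ?_
  suffices cum s z < cum s m + ρ * (z - m) by
    rw [tail, tail]
    linarith
  rcases lt_or_gt_of_ne hne with hzm | hmz
  · exact (lt_chordSlope_iff hzm).1 (hρr.trans_le (h.le_slope z hz hzm))
  · exact (chordSlope_lt_iff hmz).1 ((hright z hmz hzV).trans_lt hr'ρ)

theorem IsVertexSlope.isSupportingSegment (hs : IsStackDistribution V s)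
    (h : IsVertexSlope V s m r) (he : IsNextVertex V s m e) :
    IsSupportingSegment V s m e (chordSlope s m e) (tail s m + chordSlope s m e * m) where
  nonneg := (he.slope_pos hs).le
  le z hz hzV := by
    have := h.cum_le he hz hzV
    rw [tail, tail]
    linarith
  left _ := rfl
  right := by
    have := chordSlope_mul (s := s) he.lt
    rw [tail, tail]
    linarith
  le_last := he.le_last
  right_eq_one hm := absurd hm (Nat.ne_zero_of_lt h.one_le)

theorem HullChain.mem_iff_isSupportedEv [NeZero V] (hs : IsStackDistribution V s)
    (hl : HullChain V s m l) (h : IsVertexSlope V s m r) {k : ℕ} (hmk : m ≤ k) (hkV : k ≤ V) :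
    k ∈ m :: l ↔ IsSupportedEv V s k := by
  induction hl generalizing r with
  | last =>
    obtain rfl : k = V := hkV.antisymm hmk
    simp [h.isSupportedEv hs .last]
  | @cons m e l he hl ih =>
    rcases hmk.eq_or_lt with rfl | hmk'
    · simp [h.isSupportedEv hs (.cons he hl)]
    rw [List.mem_cons, or_iff_right hmk'.ne']
    rcases lt_or_ge k e with hke | hek
    · have hsegment := h.isSupportingSegment hs he
      exact iff_of_false (fun hmem => hke.not_ge (hl.mem_Icc k hmem).1)
        (not_isSupportedEv_of_le hs h.one_le hmk' hke he.le_last rfl hsegment.right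
          (hsegment.le k (h.one_le.trans hmk) hkV))
    · exact ih (h.next hs he) hek

theorem HullChain.mem_one_cons_iff [NeZero V] (hs : IsStackDistribution V s)
    (hl : HullChain V s 1 l) (k : ℕ) : k ∈ 1 :: l ↔ 1 ≤ k ∧ k ≤ V ∧ IsSupportedEv V s k := by
  have hiff {k : ℕ} : 1 ≤ k → k ≤ V → (k ∈ 1 :: l ↔ IsSupportedEv V s k) :=
    hl.mem_iff_isSupportedEv hs (isVertexSlope_one hs)
  refine ⟨fun hk => ?_, fun ⟨h1k, hkV, hk⟩ => (hiff h1k hkV).2 hk⟩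
  obtain ⟨h1k, hkV⟩ := hl.mem_Icc k hk
  exact ⟨h1k, hkV, (hiff h1k hkV).1 hk⟩

theorem isSupportingSegment_zero_one (hs : IsStackDistribution V s) :
    IsSupportingSegment V s 0 1 2 (tail s 1 + 2 * (1 : ℕ)) where
  nonneg := zero_le_two
  le z hz hzV := by
    rcases hz.eq_or_lt with rfl | hz
    · exact le_rfl
    · have := (chordSlope_lt_iff hz).1 ((isVertexSlope_one hs).slope_lt z hz hzV)
      rw [tail, tail]
      linarith
  left h := absurd h Nat.zero_lt_one.not_ge
  right := rfl
  le_last := hs.one_le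
  right_eq_one _ := rfl

theorem HullChain.exists_isSupportingSegment (hs : IsStackDistribution V s)
    (hl : HullChain V s m l) (h : IsVertexSlope V s m r) {K L : ℕ} (hKL : [K, L] <:+: m :: l) :
    ∃ r w, IsSupportingSegment V s K L r w := by
  induction hl generalizing r with
  | last => exact absurd hKL.length_le (by simp)
  | @cons m e l he hl ih =>
    rcases List.infix_cons_iff.1 hKL with hprefix | hinfix
    · obtain ⟨rfl, rfl⟩ : K = m ∧ L = e := by simpa using hprefix
      exact ⟨_, _, h.isSupportingSegment hs he⟩
    · exact ih (h.next hs he) hinfix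

theorem HullChain.exists_isSupportingSegment_zero_cons (hs : IsStackDistribution V s)
    (hl : HullChain V s 1 l) {K L : ℕ} (hKL : [K, L] <:+: 0 :: 1 :: l) :
    ∃ r w, IsSupportingSegment V s K L r w := by
  rcases List.infix_cons_iff.1 hKL with hprefix | hinfix
  · obtain ⟨rfl, rfl⟩ : K = 0 ∧ L = 1 := by simpa using hprefix
    exact ⟨_, _, isSupportingSegment_zero_one hs⟩
  · exact hl.exists_isSupportingSegment hs (isVertexSlope_one hs) hinfix

end Hull

theorem exists_forall_infix_pair_iff {α : Type*} [LinearOrder α] {a b c : α} {l : List α}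
    (hl : (a :: l).Pairwise (· < ·)) (hac : a < c) (hb : b ∈ l) (hcb : c ≤ b) :
    ∃ K L, ∀ K' L', ([K', L'] <:+: a :: l ∧ K' < c ∧ c ≤ L') ↔ K' = K ∧ L' = L := by
  induction l generalizing a with
  | nil => simp at hb
  | cons e l ih =>
    rcases le_or_gt c e with hce | hec
    · refine ⟨a, e, fun K' L' => ⟨?_, ?_⟩⟩
      · rintro ⟨hinfix, hK', _⟩
        rcases List.infix_cons_iff.1 hinfix with hprefix | hinfix
        · simpa using hprefix
        · have heK' : e ≤ K' := by
            rcases List.mem_cons.1 (hinfix.subset List.mem_cons_self) with rfl | hmem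
            · exact le_rfl
            · exact (List.rel_of_pairwise_cons hl.of_cons hmem).le
          exact absurd (hce.trans heK') hK'.not_ge
      · rintro ⟨rfl, rfl⟩
        exact ⟨(List.prefix_append [K', L'] l).isInfix, hac, hce⟩
    · have hbl : b ∈ l := (List.mem_cons.1 hb).resolve_left (hec.trans_le hcb).ne'
      obtain ⟨K, L, hKL⟩ := ih hl.of_cons hec hbl
      refine ⟨K, L, fun K' L' => ?_⟩
      rw [← hKL K' L', List.infix_cons_iff]
      refine and_congr_left fun ⟨_, hcL'⟩ => or_iff_right fun hprefix => ?_
      obtain ⟨rfl, rfl⟩ : K' = a ∧ L' = e := by simpa using hprefix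
      exact hec.not_ge hcL'

/-! ### The fixed capacity problem -/

instance (V : ℕ) : Finite (BufferState V) :=
  Finite.of_injective (fun x : BufferState V => (x.stack, x.buffer)) fun x y h => by
    cases x; cases y; simpa using h

section BufferStep

variable {V C : ℕ} {μ : Policy V} {t : ℕ} {x : BufferState V} {d z : Fin V}

theorem rotate_cycleRange (Λ : Equiv.Perm (Fin V)) (d z : Fin V) :
    rotate Λ d (Fin.cycleRange d z) = Λ z := by
  simp [rotate]

theorem bufferStep_stack_cycleRange :
    (bufferStep μ t x d).stack (Fin.cycleRange d z) = x.stack z :=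
  rotate_cycleRange _ _ _

theorem self_mem_bufferStep : x.stack d ∈ (bufferStep μ t x d).buffer :=
  mem_insert_self _ _

theorem mem_bufferStep_iff (h : d ≠ z) : x.stack z ∈ (bufferStep μ t x d).buffer ↔
    x.stack z ∈ x.buffer ∧ μ t x d ≠ some (x.stack z) := by
  simp [bufferStep, x.stack.injective.ne h.symm]

theorem buffer_bufferStep_of_eq_none (h : μ t x d = none) :
    (bufferStep μ t x d).buffer = insert (x.stack d) x.buffer := by
  simp [bufferStep, h]

theorem Policy.Admissible.card_bufferStep (hμ : μ.Admissible C) (hx : x.buffer.card ≤ C) :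
    (bufferStep μ t x d).buffer.card =
      x.buffer.card + if x.stack d ∉ x.buffer ∧ x.buffer.card < C then 1 else 0 := by
  have hcontrol := hμ t x d hx
  rw [AdmissibleControl] at hcontrol
  by_cases hd : x.stack d ∈ x.buffer
  · rw [if_neg fun h => h.1 hd] at hcontrol
    rw [buffer_bufferStep_of_eq_none hcontrol, insert_eq_of_mem hd, if_neg fun h => h.1 hd,
      add_zero]
  rcases hx.lt_or_eq with hlt | hfull
  · rw [if_neg fun h => hlt.ne h.2] at hcontrol
    rw [buffer_bufferStep_of_eq_none hcontrol, card_insert_of_notMem hd, if_pos ⟨hd, hlt⟩]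
  · rw [if_pos ⟨hd, hfull⟩] at hcontrol
    obtain ⟨j, hj, hevict⟩ := hcontrol
    rw [bufferStep, hevict, Option.toFinset_some, sdiff_singleton_eq_erase,
      card_insert_of_notMem fun h => hd (mem_of_mem_erase h), card_erase_add_one hj,
      if_neg fun h => h.2.ne hfull, add_zero]

theorem Policy.Admissible.card_bufferStep_le (hμ : μ.Admissible C) (hx : x.buffer.card ≤ C) :
    (bufferStep μ t x d).buffer.card ≤ C := by
  rw [hμ.card_bufferStep hx]
  split_ifs <;> omega

theorem Policy.Admissible.card_add_le_mean_card (hμ : μ.Admissible C) {s : ℕ → ℝ}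
    (hs : IsStackDistribution V s) (hx : x.buffer.card < C) (hz : (z : ℕ) + 1 = V)
    (hmem : x.stack z ∉ x.buffer) :
    x.buffer.card + s V ≤ mean s fun d => ((bufferStep μ t x d).buffer.card : ℝ) := by
  calc x.buffer.card + s V
      = mean s fun d : Fin V => (x.buffer.card : ℝ) + if d = z then 1 else 0 := by
        rw [mean_add, mean_const hs.sum_fin]
        simp [mean, hz]
    _ ≤ mean s fun d => ((bufferStep μ t x d).buffer.card : ℝ) :=
        mean_mono hs.nonneg_fin fun d => by
          rw [hμ.card_bufferStep hx.le]
          by_cases hd : d = z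
          · subst hd
            simp [hx, hmem]
          · rw [if_neg hd, Nat.cast_add, Nat.cast_ite, Nat.cast_one, Nat.cast_zero]
            gcongr
            positivity

end BufferStep

section Potential

variable {V : ℕ} {s : ℕ → ℝ} {r w : ℝ}

/-- Relative value of an item of the buffer at position `z`, when a unit of occupancy costs `r`
and an item costs `w / V` per step. -/
noncomputable def keptValue (V : ℕ) (s : ℕ → ℝ) (r w : ℝ) (z : ℕ) : ℝ :=
  z * (w / V - r) / tail s z

/-- Relative value of an item at position `z` outside of the buffer; unlike the value of an item
of the buffer it does not depend on the price of occupancy, as the next access has value `0`. -/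
noncomputable def missingValue (V : ℕ) (s : ℕ → ℝ) (w : ℝ) (z : ℕ) : ℝ :=
  (tail s z - (V - z) * (w / V)) / tail s z

/-- Relative value of an item at position `z`, which is in the buffer if `b`. -/
noncomputable def itemValue (V : ℕ) (s : ℕ → ℝ) (r w : ℝ) (z : ℕ) (b : Prop) [Decidable b] : ℝ :=
  if b then keptValue V s r w z else missingValue V s w z

/-- The sum of the relative values of all the items. -/
noncomputable def bufferValue (s : ℕ → ℝ) (r w : ℝ) (x : BufferState V) : ℝ :=
  ∑ z : Fin V, itemValue V s r w z (x.stack z ∈ x.buffer)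

/-- The part of the item at position `z` in the cost of a step plus the value of the next state. -/
noncomputable def itemContribution (s : ℕ → ℝ) (r w : ℝ) (μ : Policy V) (t : ℕ)
    (x : BufferState V) (z d : Fin V) : ℝ :=
  (if d = z ∧ x.stack z ∉ x.buffer then 1 else 0) +
    itemValue V s r w (Fin.cycleRange d z) (x.stack z ∈ (bufferStep μ t x d).buffer)

theorem keptValue_zero : keptValue V s r w 0 = 0 := by simp [keptValue]

theorem keptValue_le_missingValue (hs : IsStackDistribution V s) {z : ℕ} (hz : z < V)
    (h : w ≤ tail s z + r * z) : keptValue V s r w z ≤ missingValue V s w z := by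
  refine div_le_div_of_nonneg_right ?_ (hs.tail_pos hz).le
  have := mul_div_cancel₀ w hs.cast_pos.ne'
  linarith

theorem keptValue_eq_missingValue (hs : IsStackDistribution V s) {z : ℕ}
    (h : tail s z + r * z = w) : keptValue V s r w z = missingValue V s w z := by
  rw [keptValue, missingValue]
  have := mul_div_cancel₀ w hs.cast_pos.ne'
  congr 1
  linarith

theorem mean_keptValue (hs : IsStackDistribution V s) (z : Fin V) :
    mean s (fun d => keptValue V s r w (Fin.cycleRange d z)) =
      w / V + keptValue V s r w z - r + if (z : ℕ) + 1 < V then 0 else r * V - w := by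
  have htelescope := cum_mul_div_tail_add hs (fun y => y * (w / V - r)) z.is_lt
  rw [mean_cycleRange hs, keptValue_zero, mul_zero, add_zero]
  refine htelescope.trans ?_
  rw [keptValue]
  split_ifs with hz
  · push_cast
    ring
  · have hzV : (z : ℝ) = V - 1 := eq_sub_of_add_eq (mod_cast (by omega : (z : ℕ) + 1 = V))
    have := mul_div_cancel₀ w hs.cast_pos.ne'
    simp only [hzV]
    linarith

theorem mean_itemContribution_of_notMem (hs : IsStackDistribution V s) {μ : Policy V} {t : ℕ}
    {x : BufferState V} {z : Fin V} (hz : x.stack z ∉ x.buffer) :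
    mean s (itemContribution s r w μ t x z) = w / V + missingValue V s w z := by
  have hother : ∀ d, d ≠ z → itemContribution s r w μ t x z d =
      missingValue V s w (Fin.cycleRange d z) := fun d hd => by
    rw [itemContribution, itemValue, if_neg fun h => hd h.1,
      if_neg fun h => hz ((mem_bufferStep_iff hd).1 h).1, zero_add]
  have haccess : itemContribution s r w μ t x z z = 1 := by
    rw [itemContribution, itemValue, if_pos ⟨rfl, hz⟩, if_pos self_mem_bufferStep,
      coe_cycleRange_self, keptValue_zero, add_zero]
  have htelescope := cum_mul_div_tail_add_of_last_eq_zero hs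
    (a := fun y => tail s y - (V - y) * (w / V)) (by simp [hs.tail_last]) z.is_lt
  rw [mean_eq_of_trichotomy hs (a := missingValue V s w z) (b := missingValue V s w (z + 1))
    (fun d hd => by rw [hother d hd.ne, Fin.cycleRange_of_gt hd])
    (fun d hd => by rw [hother d hd.ne', Fin.coe_cycleRange_of_lt hd]), haccess]
  simp only [missingValue]
  rw [tail_succ] at htelescope ⊢
  push_cast at htelescope ⊢
  linarith

theorem bufferMiss_add_bufferValue (μ : Policy V) (t : ℕ) (x : BufferState V) (d : Fin V) :
    bufferMiss x d + bufferValue s r w (bufferStep μ t x d) =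
      ∑ z, itemContribution s r w μ t x z d := by
  have hmiss : bufferMiss x d = ∑ z, if d = z ∧ x.stack z ∉ x.buffer then (1 : ℝ) else 0 := by
    simp [bufferMiss, ite_and, ite_not]
  have hvalue : bufferValue s r w (bufferStep μ t x d) = ∑ z, itemValue V s r w
      (Fin.cycleRange d z) (x.stack z ∈ (bufferStep μ t x d).buffer) := by
    rw [bufferValue, ← Equiv.sum_comp (Fin.cycleRange d)]
    simp only [bufferStep_stack_cycleRange]
  rw [hmiss, hvalue, ← sum_add_distrib]
  rfl

theorem gain_add_bufferValue (hs : IsStackDistribution V s) (x : BufferState V) :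
    w - r * x.buffer.card + bufferValue s r w x =
      ∑ z : Fin V, (w / V + itemValue V s r w z (x.stack z ∈ x.buffer) -
        if x.stack z ∈ x.buffer then r else 0) := by
  have hoccupancy : ∑ z : Fin V, (if x.stack z ∈ x.buffer then r else 0) = r * x.buffer.card := by
    rw [Equiv.sum_comp x.stack fun j => if j ∈ x.buffer then r else 0, sum_ite_mem, univ_inter,
      sum_const, nsmul_eq_mul, mul_comm]
  rw [sum_sub_distrib, sum_add_distrib, hoccupancy, sum_const, card_univ, Fintype.card_fin,
    nsmul_eq_mul, mul_div_cancel₀ _ hs.cast_pos.ne', bufferValue]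
  ring

variable {K L : ℕ} {μ : Policy V} {t : ℕ} {x : BufferState V}

theorem keptValue_le_itemContribution (hs : IsStackDistribution V s)
    (h : IsSupportingSegment V s K L r w) (z d : Fin V) :
    keptValue V s r w (Fin.cycleRange d z) ≤ itemContribution s r w μ t x z d := by
  rw [itemContribution, itemValue]
  refine le_add_of_nonneg_of_le (by positivity) ?_
  split_ifs with hmem
  · exact le_rfl
  · have hdz : d ≠ z := by
      rintro rfl
      exact hmem self_mem_bufferStep
    exact keptValue_le_missingValue hs (Fin.cycleRange d z).is_lt
      (h.le _ (one_le_coe_cycleRange hdz) (Fin.cycleRange d z).is_lt.le)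

theorem itemContribution_eq_keptValue (hs : IsStackDistribution V s) {z d : Fin V}
    (hz : x.stack z ∈ x.buffer) (htight : μ t x d = some (x.stack z) →
      tail s (Fin.cycleRange d z) + r * (Fin.cycleRange d z : ℕ) = w) :
    itemContribution s r w μ t x z d = keptValue V s r w (Fin.cycleRange d z) := by
  rw [itemContribution, if_neg fun h => h.2 hz, zero_add, itemValue]
  split_ifs with hmem
  · rfl
  · have hdz : d ≠ z := by
      rintro rfl
      exact hmem self_mem_bufferStep
    have hevict : μ t x d = some (x.stack z) :=
      by_contra fun hkeep => hmem ((mem_bufferStep_iff hdz).2 ⟨hz, hkeep⟩)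
    exact (keptValue_eq_missingValue hs (htight hevict)).symm

/-- The reason for the inequality: at the price `r`, keeping an item is never worse than evicting
it. -/
theorem IsSupportingSegment.le_mean_bufferMiss_add_bufferValue
    (h : IsSupportingSegment V s K L r w) (hs : IsStackDistribution V s) (μ : Policy V) (t : ℕ)
    (x : BufferState V) :
    w - r * x.buffer.card + bufferValue s r w x ≤
      mean s fun d => bufferMiss x d + bufferValue s r w (bufferStep μ t x d) := by
  simp only [bufferMiss_add_bufferValue]
  rw [gain_add_bufferValue hs, mean_sum]
  refine sum_le_sum fun z _ => ?_
  by_cases hz : x.stack z ∈ x.buffer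
  · have hlast : w ≤ r * V := by simpa [hs.tail_last] using h.le V hs.one_le le_rfl
    have hboundary : 0 ≤ if (z : ℕ) + 1 < V then 0 else r * V - w := by
      split_ifs <;> linarith
    rw [if_pos hz, itemValue, if_pos hz]
    calc w / V + keptValue V s r w z - r
        ≤ mean s fun d => keptValue V s r w (Fin.cycleRange d z) := by
          rw [mean_keptValue hs]
          linarith
      _ ≤ mean s (itemContribution s r w μ t x z) :=
          mean_mono hs.nonneg_fin (keptValue_le_itemContribution hs h z)
  · rw [if_neg hz, itemValue, if_neg hz, sub_zero, mean_itemContribution_of_notMem hs hz]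

theorem mean_bufferMiss_add_bufferValue_of_tight (hs : IsStackDistribution V s)
    (htight : ∀ d z, x.stack z ∈ x.buffer → μ t x d = some (x.stack z) →
      tail s (Fin.cycleRange d z) + r * (Fin.cycleRange d z : ℕ) = w)
    (hlast : ∀ z : Fin V, (z : ℕ) + 1 = V → x.stack z ∈ x.buffer → r * V = w) :
    (mean s fun d => bufferMiss x d + bufferValue s r w (bufferStep μ t x d)) =
      w - r * x.buffer.card + bufferValue s r w x := by
  simp only [bufferMiss_add_bufferValue]
  rw [gain_add_bufferValue hs, mean_sum]
  refine sum_congr rfl fun z _ => ?_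
  by_cases hz : x.stack z ∈ x.buffer
  · have hboundary : (if (z : ℕ) + 1 < V then 0 else r * V - w) = 0 :=
      ite_eq_left_iff.2 fun hzV => sub_eq_zero.2 (hlast z (by omega) hz)
    have hcontribution : itemContribution s r w μ t x z =
        fun d => keptValue V s r w (Fin.cycleRange d z) :=
      funext fun d => itemContribution_eq_keptValue hs hz (htight d z hz)
    rw [if_pos hz, itemValue, if_pos hz, hcontribution, mean_keptValue hs, hboundary, add_zero]
  · rw [if_neg hz, itemValue, if_neg hz, sub_zero, mean_itemContribution_of_notMem hs hz]

end Potential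

section GainOptimality

variable {V : ℕ} {s : ℕ → ℝ} {K L C t : ℕ} {r w : ℝ} {μ : Policy V} {x : BufferState V}
  {d : Fin V}

theorem IsSupportingSegment.isSubsolution (h : IsSupportingSegment V s K L r w)
    (hs : IsStackDistribution V s) (hμ : μ.Admissible C) :
    IsSubsolution s bufferMiss (bufferStep μ) {x | x.buffer.card ≤ C} (w - r * C)
      (bufferValue s r w) where
  step_mem _ _ hx _ := hμ.card_bufferStep_le hx
  bddAbove := (Set.toFinite _).bddAbove
  le_mean t x hx := by
    have hcard : r * x.buffer.card ≤ r * C := mul_le_mul_of_nonneg_left (Nat.cast_le.2 hx) h.nonneg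
    linarith [h.le_mean_bufferMiss_add_bufferValue hs μ t x]

theorem klPolicy_eq_none (h : ¬(x.stack d ∉ x.buffer ∧ x.buffer.card = C)) :
    klPolicy C K L t x d = none :=
  if_neg h

theorem klPolicy_admissible (hC : 1 ≤ C) : (klPolicy C K L : Policy V).Admissible C := by
  intro t x d _
  rw [AdmissibleControl]
  split_ifs with h
  · obtain ⟨j, hj⟩ : x.buffer.Nonempty := card_pos.1 (h.2 ▸ hC)
    have hfound : (klPolicy C K L t x d).isSome := by
      rw [klPolicy, if_pos h, List.find?_isSome]
      refine ⟨j, List.mem_append_right _ ?_, decide_eq_true hj⟩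
      exact List.mem_reverse.2 (List.mem_ofFn.2 ((rotate x.stack d).surjective j))
    obtain ⟨i, hi⟩ := Option.isSome_iff_exists.1 hfound
    refine ⟨i, ?_, hi⟩
    rw [klPolicy, if_pos h] at hi
    simpa using List.find?_some hi
  · exact klPolicy_eq_none h

theorem klPolicy_eq_of_right_mem (h : x.stack d ∉ x.buffer ∧ x.buffer.card = C) {z : Fin V}
    (hz : x.stack z ∈ x.buffer) (hzL : (Fin.cycleRange d z : ℕ) = L) :
    klPolicy C K L t x d = some (x.stack z) := by
  simp [klPolicy, if_pos h, ← hzL, rotate_cycleRange, hz]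

theorem klPolicy_eq_of_left_mem (h : x.stack d ∉ x.buffer ∧ x.buffer.card = C)
    (hL : ∀ y, x.stack y ∈ x.buffer → (Fin.cycleRange d y : ℕ) ≠ L) {z : Fin V}
    (hz : x.stack z ∈ x.buffer) (hzK : (Fin.cycleRange d z : ℕ) = K) :
    klPolicy C K L t x d = some (x.stack z) := by
  have hright : ∀ hLV : L < V, rotate x.stack d ⟨L, hLV⟩ ∉ x.buffer := fun hLV hmem => by
    obtain ⟨y, hy⟩ := (Fin.cycleRange d).surjective ⟨L, hLV⟩
    rw [← hy, rotate_cycleRange] at hmem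
    exact hL y hmem (congrArg Fin.val hy)
  by_cases hLV : L < V
  · simp [klPolicy, if_pos h, ← hzK, rotate_cycleRange, hz, hLV, hright]
  · simp [klPolicy, if_pos h, ← hzK, rotate_cycleRange, hz, hLV]

/-- The buffer holds exactly the most recently used items. -/
def HoldsTop (x : BufferState V) : Prop :=
  ∀ z, x.stack z ∈ x.buffer ↔ (z : ℕ) < x.buffer.card

/-- The buffer holds the `K` most recently used items, and none below depth `L`. -/
structure IsBetween (K L : ℕ) (x : BufferState V) : Prop where
  top_mem : ∀ z : Fin V, (z : ℕ) < K → x.stack z ∈ x.buffer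
  lt_of_mem : ∀ z : Fin V, x.stack z ∈ x.buffer → (z : ℕ) < L

theorem HoldsTop.isBetween (hx : HoldsTop x) (hK : K ≤ x.buffer.card) (hL : x.buffer.card ≤ L) :
    IsBetween K L x where
  top_mem z hz := (hx z).2 (hz.trans_le hK)
  lt_of_mem z hz := ((hx z).1 hz).trans_le hL

theorem HoldsTop.bufferStep (hx : HoldsTop x) (h : μ t x d = none) :
    HoldsTop (bufferStep μ t x d) := by
  intro y
  obtain ⟨z, rfl⟩ := (Fin.cycleRange d).surjective y
  rw [bufferStep_stack_cycleRange]
  rcases eq_or_ne d z with rfl | hdz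
  · rw [coe_cycleRange_self]
    exact iff_of_true self_mem_bufferStep (card_pos.2 ⟨_, self_mem_bufferStep⟩)
  have hval : (d : ℕ) ≠ z := Fin.val_ne_of_ne hdz
  rw [mem_bufferStep_iff hdz, and_iff_left (by simp [h]), hx z, buffer_bufferStep_of_eq_none h,
    coe_cycleRange, if_neg hdz.symm]
  simp only [Fin.lt_def]
  by_cases hd : x.stack d ∈ x.buffer
  · have := (hx d).1 hd
    rw [insert_eq_of_mem hd]
    split_ifs <;> omega
  · have := mt (hx d).2 hd
    rw [card_insert_of_notMem hd]
    split_ifs <;> omega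

theorem IsBetween.bufferStep (hx : IsBetween K L x) (hL : 1 ≤ L)
    (hkeep : ∀ z, μ t x d = some (x.stack z) → K ≤ Fin.cycleRange d z)
    (hdrop : ∀ z, x.stack z ∈ x.buffer → (Fin.cycleRange d z : ℕ) = L →
      μ t x d = some (x.stack z)) : IsBetween K L (bufferStep μ t x d) where
  top_mem y hy := by
    obtain ⟨z, rfl⟩ := (Fin.cycleRange d).surjective y
    rw [bufferStep_stack_cycleRange]
    rcases eq_or_ne d z with rfl | hdz
    · exact self_mem_bufferStep
    · exact (mem_bufferStep_iff hdz).2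
        ⟨hx.top_mem z ((le_coe_cycleRange hdz).trans_lt hy), fun h => (hkeep z h).not_gt hy⟩
  lt_of_mem y hy := by
    obtain ⟨z, rfl⟩ := (Fin.cycleRange d).surjective y
    rw [bufferStep_stack_cycleRange] at hy
    rcases eq_or_ne d z with rfl | hdz
    · rwa [coe_cycleRange_self]
    · obtain ⟨hz, hevict⟩ := (mem_bufferStep_iff hdz).1 hy
      exact ((coe_cycleRange_le d z).trans (hx.lt_of_mem z hz)).lt_of_ne
        fun h => hevict (hdrop z hz h)

theorem IsBetween.cycleRange_ne_right_of_mem (hx : IsBetween K L x) (hL : 1 ≤ L)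
    (hd : x.stack d ∈ x.buffer) {z : Fin V} (hz : x.stack z ∈ x.buffer) :
    (Fin.cycleRange d z : ℕ) ≠ L := by
  have hdL := hx.lt_of_mem d hd
  have hzL := hx.lt_of_mem z hz
  rw [coe_cycleRange]
  simp only [Fin.lt_def]
  split_ifs <;> omega

theorem IsBetween.exists_klPolicy_eq_some (hx : IsBetween K L x) (hKL : K = 0 → L = 1)
    (hC : 1 ≤ C) (h : x.stack d ∉ x.buffer ∧ x.buffer.card = C) :
    ∃ z, x.stack z ∈ x.buffer ∧ klPolicy C K L t x d = some (x.stack z) ∧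
      ((Fin.cycleRange d z : ℕ) = L ∨ 1 ≤ K ∧ (Fin.cycleRange d z : ℕ) = K) ∧
      ∀ y, x.stack y ∈ x.buffer → (Fin.cycleRange d y : ℕ) = L → y = z := by
  by_cases hright : ∃ z, x.stack z ∈ x.buffer ∧ (Fin.cycleRange d z : ℕ) = L
  · obtain ⟨z, hz, hzL⟩ := hright
    exact ⟨z, hz, klPolicy_eq_of_right_mem h hz hzL, Or.inl hzL, fun y _ hyL =>
      (Fin.cycleRange d).injective (Fin.ext (hyL.trans hzL.symm))⟩
  push Not at hright
  have hdK : K ≤ (d : ℕ) := not_lt.1 fun hd => h.1 (hx.top_mem d hd)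
  have hK : K ≠ 0 := by
    intro hK
    obtain ⟨j, hj⟩ : x.buffer.Nonempty := card_pos.1 (h.2 ▸ hC)
    obtain ⟨y, rfl⟩ := x.stack.surjective j
    have hy := hx.lt_of_mem y hj
    have hdy : (d : ℕ) ≠ y := Fin.val_ne_of_ne fun hdy => h.1 (hdy ▸ hj)
    refine hright y hj ?_
    rw [Fin.coe_cycleRange_of_lt (Fin.lt_def.2 (by omega))]
    omega
  have hz := hx.top_mem (⟨K - 1, by omega⟩ : Fin V) (Nat.sub_one_lt hK)
  have hzK : (Fin.cycleRange d ⟨K - 1, by omega⟩ : ℕ) = K := by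
    rw [Fin.coe_cycleRange_of_lt (Fin.lt_def.2 (by dsimp only; omega))]
    exact Nat.sub_one_add_one hK
  exact ⟨_, hz, klPolicy_eq_of_left_mem h hright hz hzK, Or.inr ⟨Nat.one_le_iff_ne_zero.2 hK, hzK⟩,
    fun y hy hyL => absurd hyL (hright y hy)⟩

/-- The states reached by the `K`-`L` policy from an empty buffer of capacity `C`: while it is
being filled, the buffer holds the most recently used items. -/
def KLInvariant (C K L : ℕ) (x : BufferState V) : Prop :=
  x.buffer.card < C ∧ HoldsTop x ∨ x.buffer.card = C ∧ IsBetween K L x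

theorem KLInvariant.isBetween (hx : KLInvariant C K L x)
    (h : x.stack d ∉ x.buffer ∧ x.buffer.card = C) : IsBetween K L x :=
  (hx.resolve_left fun hlt => hlt.1.ne h.2).2

theorem KLInvariant.lt_of_mem (hx : KLInvariant C K L x) (hCL : C ≤ L) {z : Fin V}
    (hz : x.stack z ∈ x.buffer) : (z : ℕ) < L :=
  hx.elim (fun h => ((h.2 z).1 hz).trans_le (h.1.le.trans hCL)) fun h => h.2.lt_of_mem z hz

theorem KLInvariant.bufferStep (hKL : K = 0 → L = 1) (hKC : K < C) (hCL : C ≤ L)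
    (hx : KLInvariant C K L x) : KLInvariant C K L (bufferStep (klPolicy C K L) t x d) := by
  have hμ : (klPolicy C K L : Policy V).Admissible C := klPolicy_admissible (by omega)
  rcases hx with ⟨hlt, htop⟩ | ⟨hfull, hbetween⟩
  · have htop' := htop.bufferStep (klPolicy_eq_none (K := K) (L := L) (t := t) (d := d)
      fun h => hlt.ne h.2)
    rcases (hμ.card_bufferStep_le (t := t) (d := d) hlt.le).lt_or_eq with hlt' | hfull'
    · exact Or.inl ⟨hlt', htop'⟩
    · exact Or.inr ⟨hfull', htop'.isBetween (hKC.le.trans hfull'.ge) (hfull'.le.trans hCL)⟩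
  · refine Or.inr ⟨?_, ?_⟩
    · rw [hμ.card_bufferStep hfull.le, if_neg fun h => h.2.ne hfull, add_zero, hfull]
    by_cases hd : x.stack d ∈ x.buffer
    · have hnone : klPolicy C K L t x d = none := klPolicy_eq_none fun h => h.1 hd
      refine hbetween.bufferStep (by omega) (fun z hz => by simp [hnone] at hz) fun z hz hzL => ?_
      exact absurd hzL (hbetween.cycleRange_ne_right_of_mem (by omega) hd hz)
    · obtain ⟨z, -, hevict, hpos, hunique⟩ :=
        hbetween.exists_klPolicy_eq_some (t := t) hKL (by omega) ⟨hd, hfull⟩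
      refine hbetween.bufferStep (by omega) (fun y hy => ?_) fun y hy hyL => ?_
      · obtain rfl := x.stack.injective (Option.some.inj (hevict.symm.trans hy))
        omega
      · rw [hunique y hy hyL, hevict]

theorem IsSupportingSegment.mean_bufferMiss_add_bufferValue_klPolicy
    (h : IsSupportingSegment V s K L r w) (hs : IsStackDistribution V s) (hKC : K < C)
    (hCL : C ≤ L) (hx : KLInvariant C K L x) :
    (mean s fun d => bufferMiss x d + bufferValue s r w (bufferStep (klPolicy C K L) t x d)) =
      w - r * x.buffer.card + bufferValue s r w x := by
  refine mean_bufferMiss_add_bufferValue_of_tight hs (fun d z _ hevict => ?_) fun z hzV hz => ?_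
  · have hmiss : x.stack d ∉ x.buffer ∧ x.buffer.card = C := by
      by_contra hhit
      simp [klPolicy_eq_none hhit] at hevict
    obtain ⟨y, -, hy, hpos, -⟩ := (hx.isBetween hmiss).exists_klPolicy_eq_some (t := t)
      h.right_eq_one (by omega) hmiss
    obtain rfl := x.stack.injective (Option.some.inj (hy.symm.trans hevict))
    rcases hpos with hL | ⟨hK, hzK⟩
    · rw [hL, h.right]
    · rw [hzK, h.left hK]
  · obtain rfl : L = V := le_antisymm h.le_last (hzV ▸ hx.lt_of_mem hCL hz)
    rw [← h.right, hs.tail_last, zero_add]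

/-- While the buffer is filled, the unused occupancy makes the equality with the gain
`w - r * card` exceed `w - r * C`; the correction term pays for this, as a free place is used up
with probability at least `s V`. -/
theorem IsSupportingSegment.isSupersolution_klPolicy (h : IsSupportingSegment V s K L r w)
    (hs : IsStackDistribution V s) (hKC : K < C) (hCL : C ≤ L) :
    IsSupersolution s bufferMiss (bufferStep (klPolicy C K L))
      {x : BufferState V | KLInvariant C K L x} (w - r * C)
      (fun x => bufferValue s r w x + -(r * C / s V) * x.buffer.card) where
  step_mem _ _ hx _ := KLInvariant.bufferStep h.right_eq_one hKC hCL hx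
  bddBelow := (Set.toFinite _).bddBelow
  mean_le t x hx := by
    have hμ : (klPolicy C K L : Policy V).Admissible C := klPolicy_admissible (by omega)
    have hfree : r * (C - x.buffer.card) ≤ r * C / s V *
        ((mean s fun d => ((bufferStep (klPolicy C K L) t x d).buffer.card : ℝ)) -
          x.buffer.card) := by
      rcases hx with ⟨hlt, htop⟩ | ⟨hfull, -⟩
      · have hV := hs.one_le
        have hlast : x.stack ⟨V - 1, by omega⟩ ∉ x.buffer := fun hmem => by
          have := (htop _).1 hmem
          have := h.le_last
          dsimp only at *
          omega
        calc r * (C - x.buffer.card) ≤ r * C :=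
              mul_le_mul_of_nonneg_left (sub_le_self _ (Nat.cast_nonneg _)) h.nonneg
          _ = r * C / s V * s V := (div_mul_cancel₀ _ hs.last_pos.ne').symm
          _ ≤ _ := by
            gcongr
            · exact div_nonneg (mul_nonneg h.nonneg C.cast_nonneg) hs.last_pos.le
            · exact le_sub_iff_add_le'.2
                (hμ.card_add_le_mean_card hs hlt (Nat.sub_one_add_one (by omega)) hlast)
      · simp only [hμ.card_bufferStep hfull.le, hfull, lt_irrefl, and_false, if_false, add_zero,
          mean_const hs.sum_fin, sub_self, mul_zero, le_refl]
    simp only [← add_assoc]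
    rw [mean_add, mean_const_mul, h.mean_bufferMiss_add_bufferValue_klPolicy hs hKC hCL hx]
    linarith

theorem IsSupportingSegment.klPolicy_isGainOptimal (h : IsSupportingSegment V s K L r w)
    (hs : IsStackDistribution V s) (hKC : K < C) (hCL : C ≤ L) :
    IsGainOptimal (V := V) s C (klPolicy C K L) (w - r * C) := by
  have hC : 1 ≤ C := by omega
  have hlower : ∀ μ : Policy V, μ.Admissible C → ∀ x₀ : BufferState V, x₀.buffer.card ≤ C →
      ∀ c < w - r * C, ∀ᶠ τ : ℕ in Filter.atTop,
        c < expectedCost s bufferMiss (bufferStep μ) x₀ τ / τ := fun μ hμ x₀ hx₀ c hc =>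
    (h.isSubsolution hs hμ).eventually_lt_expectedCost hs.nonneg_fin hs.sum_fin hx₀ hc
  refine ⟨klPolicy_admissible hC, fun Λ => tendsto_order.2
    ⟨hlower _ (klPolicy_admissible hC) _ (by simp), fun c hc => ?_⟩, hlower⟩
  have hempty : KLInvariant C K L (⟨Λ, ∅⟩ : BufferState V) := Or.inl ⟨hC, by simp [HoldsTop]⟩
  exact (h.isSupersolution_klPolicy hs hKC hCL).eventually_expectedCost_lt hs.nonneg_fin hs.sum_fin
    hempty hc

end GainOptimality

/-! ### The scan -/

namespace Store

/-- Writing the value `m` into the register `x`. -/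
def setReg (σ : Store) (x : NatVar) (m : ℕ) : Store :=
  { σ with reg := Function.update σ.reg x m }

/-- Writing a block into the cell `p`: its last element `e`, its total weight `a` and its
length `b`. -/
noncomputable def setBlock (σ : Store) (p e : ℕ) (a b : ℝ) : Store :=
  { σ with
    nu := Function.update σ.nu p e
    arr := Function.update (Function.update σ.arr .pi (Function.update (σ.arr .pi) p a)) .delta
      (Function.update (σ.arr .delta) p b) }

/-- The effect of the body of `scanMerge`: the block at `n` is merged into the one at `j`. -/
noncomputable def mergeBlock (σ : Store) : Store :=
  (σ.setBlock (σ.reg .j) (σ.nu (σ.reg .n)) (σ.arr .pi (σ.reg .j) + σ.arr .pi (σ.reg .n))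
    (σ.arr .delta (σ.reg .j) + σ.arr .delta (σ.reg .n))).setReg .n (σ.nu (σ.reg .n) + 1)

/-- The effect of the body of `mainLoop` up to `scanMerge`: a block with the single element `j` is
opened. -/
noncomputable def openBlock (σ : Store) : Store :=
  (σ.setBlock (σ.reg .j) (σ.reg .j) (σ.arr .s (σ.reg .j)) 1).setReg .n (σ.reg .j + 1)

/-- The average weight of the block in the cell `p`. -/
noncomputable def blockSlope (σ : Store) (p : ℕ) : ℝ := σ.arr .pi p / σ.arr .delta p

/-- The effect of the body of `printQLoop`. -/
def printQStep (σ : Store) : Store :=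
  ({ σ with out := σ.out ++ [Output.q (σ.reg .i) (σ.nu (σ.reg .j))] }.setReg .j
    (σ.nu (σ.reg .j) + 1)).setReg .i (σ.reg .i + 1)

/-- The effect of the body of `printXiLoop`. -/
noncomputable def printXiStep (σ : Store) : Store :=
  { σ with out := σ.out ++ [Output.xi (σ.reg .j) (σ.blockSlope (σ.reg .j))] }.setReg .j
    (σ.reg .j + 1)

end Store

section Commands

local infixr:40 ";;" => Cmd.seq

/-- The loop of `scanMain`. -/
def mainLoop : Cmd :=
  .loop (.natLe (.lit 2) (.reg .j)) (
    .setNu (.reg .j) (.reg .j) ;;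
    .setArr .pi (.reg .j) (.arr .s (.reg .j)) ;;
    .setArr .delta (.reg .j) (.lit 1) ;;
    setNext ;;
    scanMerge ;;
    .setReg .j (.sub (.reg .j) (.lit 1)))

/-- The loop of `scanPrintQ`. -/
def printQLoop : Cmd :=
  .loop (.natLe (.reg .j) (.reg .V)) (
    .printQ (.reg .i) (.nu (.reg .j)) ;;
    .setReg .j (.add (.nu (.reg .j)) (.lit 1)) ;;
    .setReg .i (.add (.reg .i) (.lit 1)))

/-- The loop of `scanPrintXi`. -/
def printXiLoop : Cmd :=
  .loop (.natLe (.reg .j) (.reg .V)) (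
    .printXi (.reg .j) (ratio (.reg .j)) ;;
    .setReg .j (.add (.reg .j) (.lit 1)))

variable {σ σ₁ σ' : Store} {c : Cmd} {T T' : ℕ}

theorem Exec.of_eq (h : Exec c σ σ₁ T) (hσ : σ₁ = σ') (hT : T = T') : Exec c σ σ' T' :=
  hσ ▸ hT ▸ h

theorem exec_scanMerge_exit (h : σ.blockSlope (σ.reg .n) < σ.blockSlope (σ.reg .j)) :
    Exec scanMerge σ σ 12 :=
  .loopExit h.not_ge

theorem exec_scanMerge_step (hle : σ.blockSlope (σ.reg .j) ≤ σ.blockSlope (σ.reg .n))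
    (h : Exec scanMerge σ.mergeBlock σ' T) : Exec scanMerge σ σ' (T + 35) := by
  refine Exec.of_eq (.loopStep hle (Exec.of_eq (.seq (.setNu _ _ _) (.seq (.setArr _ _ _ _)
    (.seq (.setArr _ _ _ _) (.setReg _ _ _)))) ?_ rfl) h) rfl ?_
  · simp [Store.mergeBlock, Store.setBlock, Store.setReg, NatExpr.eval, RealExpr.eval]
  · simp only [Test.cost, ratio, RealExpr.cost, NatExpr.cost]
    omega

theorem exec_mainLoop_exit (h : σ.reg .j < 2) : Exec mainLoop σ σ 4 :=
  .loopExit h.not_ge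

theorem exec_mainLoop_step (hj : 2 ≤ σ.reg .j) (hmerge : Exec scanMerge σ.openBlock σ₁ T)
    (h : Exec mainLoop (σ₁.setReg .j (σ₁.reg .j - 1)) σ' T') :
    Exec mainLoop σ σ' (T + T' + 23) := by
  refine Exec.of_eq (.loopStep hj (.seq (.setNu _ _ _) (.seq (.setArr _ _ _ _)
    (.seq (.setArr _ _ _ _) (.seq (Exec.of_eq (.setReg _ _ _) ?_ rfl)
      (.seq hmerge (.setReg _ _ _)))))) h) rfl ?_
  · simp [Store.openBlock, Store.setBlock, Store.setReg, NatExpr.eval, RealExpr.eval]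
  · simp only [RealExpr.cost, NatExpr.cost, Test.cost]
    omega

theorem exec_printQLoop_exit (h : σ.reg .V < σ.reg .j) : Exec printQLoop σ σ 4 :=
  .loopExit h.not_ge

theorem exec_printQLoop_step (hj : σ.reg .j ≤ σ.reg .V)
    (h : Exec printQLoop σ.printQStep σ' T) : Exec printQLoop σ σ' (T + 17) := by
  refine Exec.of_eq (.loopStep hj (Exec.of_eq (.seq (.printQ _ _ _) (.seq (.setReg _ _ _)
    (.setReg _ _ _))) ?_ rfl) h) rfl ?_
  · simp [Store.printQStep, Store.setReg, NatExpr.eval]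
  · simp only [Test.cost, NatExpr.cost]
    omega

theorem exec_printXiLoop_exit (h : σ.reg .V < σ.reg .j) : Exec printXiLoop σ σ 4 :=
  .loopExit h.not_ge

theorem exec_printXiLoop_step (hj : σ.reg .j ≤ σ.reg .V)
    (h : Exec printXiLoop σ.printXiStep σ' T) : Exec printXiLoop σ σ' (T + 15) := by
  refine Exec.of_eq (.loopStep hj (.seq (.printXi _ _ _) (.setReg _ _ _)) h) rfl ?_
  simp only [Test.cost, ratio, RealExpr.cost, NatExpr.cost]
  omega

end Commands

/-- Cell `m + 1` holds the block `m + 1, …, e`. -/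
structure IsBlock (s : ℕ → ℝ) (σ : Store) (m e : ℕ) : Prop where
  nu : σ.nu (m + 1) = e
  pi : σ.arr .pi (m + 1) = cum s e - cum s m
  delta : σ.arr .delta (m + 1) = (e : ℝ) - m

/-- The state of the memory once the cells `m + 1, …, V` have been processed: the block in the
cell `i + 1` ends at the next hull vertex after `i`. -/
structure ScanInvariant (V : ℕ) (s : ℕ → ℝ) (m : ℕ) (σ : Store) : Prop where
  reg_V : σ.reg .V = V
  arr_s : ∀ j, 1 ≤ j → j ≤ V → σ.arr .s j = s j
  out_nil : σ.out = []
  nu_one : σ.nu 1 = 1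
  pi_last : σ.arr .pi (V + 1) = 0
  delta_last : σ.arr .delta (V + 1) = 1
  block : ∀ i e, m ≤ i → IsNextVertex V s i e → IsBlock s σ i e

/-- The state of the memory at the test of `scanMerge`, when the cell `m + 1` is processed and its
current block is `m + 1, …, e`. -/
structure MergeInvariant (V : ℕ) (s : ℕ → ℝ) (m e : ℕ) (σ : Store) : Prop where
  one_le : 1 ≤ m
  scan : ScanInvariant V s (m + 1) σ
  reg_j : σ.reg .j = m + 1
  reg_n : σ.reg .n = e + 1
  prefixMax : IsPrefixMax V s m e
  block : IsBlock s σ m e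

section Scan

variable {V m e f : ℕ} {s : ℕ → ℝ} {l : List ℕ} {σ : Store}

theorem IsBlock.blockSlope_eq (h : IsBlock s σ m e) :
    σ.blockSlope (m + 1) = chordSlope s m e := by
  rw [Store.blockSlope, h.pi, h.delta, chordSlope]

theorem isBlock_setBlock {a b : ℝ} (ha : a = cum s e - cum s m) (hb : b = e - m) :
    IsBlock s (σ.setBlock (m + 1) e a b) m e where
  nu := Function.update_self ..
  pi := by simp [Store.setBlock, ha]
  delta := by simp [Store.setBlock, hb]

theorem IsBlock.setReg (h : IsBlock s σ m e) (x : NatVar) (k : ℕ) :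
    IsBlock s (σ.setReg x k) m e :=
  ⟨h.nu, h.pi, h.delta⟩

theorem ScanInvariant.setReg (h : ScanInvariant V s m σ) {x : NatVar} (hx : x ≠ .V) (k : ℕ) :
    ScanInvariant V s m (σ.setReg x k) where
  reg_V := (Function.update_of_ne hx.symm ..).trans h.reg_V
  arr_s := h.arr_s
  out_nil := h.out_nil
  nu_one := h.nu_one
  pi_last := h.pi_last
  delta_last := h.delta_last
  block i e hi he := (h.block i e hi he).setReg x k

theorem ScanInvariant.setBlock (h : ScanInvariant V s m σ) (hm : 1 < m) (hmV : m ≤ V) (e : ℕ)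
    (a b : ℝ) : ScanInvariant V s m (σ.setBlock m e a b) where
  reg_V := h.reg_V
  arr_s := h.arr_s
  out_nil := h.out_nil
  nu_one := (Function.update_of_ne hm.ne ..).trans h.nu_one
  pi_last := by simp [Store.setBlock, (Nat.lt_succ_of_le hmV).ne', h.pi_last]
  delta_last := by simp [Store.setBlock, (Nat.lt_succ_of_le hmV).ne', h.delta_last]
  block i e' hi he' := by
    have hne : i + 1 ≠ m := (Nat.lt_succ_of_le hi).ne'
    have hblock := h.block i e' hi he'
    constructor <;> simp [Store.setBlock, hne, hblock.nu, hblock.pi, hblock.delta]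

theorem ScanInvariant.extend (h : ScanInvariant V s (m + 1) σ) (he : IsNextVertex V s m e)
    (hb : IsBlock s σ m e) : ScanInvariant V s m σ where
  reg_V := h.reg_V
  arr_s := h.arr_s
  out_nil := h.out_nil
  nu_one := h.nu_one
  pi_last := h.pi_last
  delta_last := h.delta_last
  block i e' hi he' := by
    rcases hi.eq_or_lt with rfl | hi
    · obtain rfl := he.unique he'
      exact hb
    · exact h.block i e' hi he'

theorem ScanInvariant.openBlock (h : ScanInvariant V s (m + 1) σ) (hj : σ.reg .j = m + 1)
    (hm : 1 ≤ m) (hmV : m < V) : MergeInvariant V s m (m + 1) σ.openBlock where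
  one_le := hm
  scan := by
    rw [Store.openBlock, hj]
    exact (h.setBlock (Nat.lt_succ_of_le hm) hmV _ _ _).setReg (by simp) _
  reg_j := hj
  reg_n := by simp [Store.openBlock, Store.setReg, hj]
  prefixMax := isPrefixMax_succ hmV
  block := by
    rw [Store.openBlock, hj, h.arr_s _ (Nat.le_add_left 1 m) hmV]
    exact (isBlock_setBlock (by rw [cum_succ]; ring) (by push_cast; ring)).setReg _ _

theorem MergeInvariant.mergeBlock (h : MergeInvariant V s m e σ) (hf : IsNextVertex V s e f)
    (hle : chordSlope s m e ≤ chordSlope s e f) : MergeInvariant V s m f σ.mergeBlock := by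
  have hnext := h.scan.block e f h.prefixMax.lt hf
  have heq : σ.mergeBlock = (σ.setBlock (m + 1) f ((cum s e - cum s m) + (cum s f - cum s e))
      ((e - m : ℝ) + (f - e))).setReg .n (f + 1) := by
    rw [Store.mergeBlock, h.reg_j, h.reg_n, h.block.pi, h.block.delta, hnext.nu, hnext.pi,
      hnext.delta]
  rw [heq]
  exact {
    one_le := h.one_le
    scan := (h.scan.setBlock (Nat.lt_succ_of_le h.one_le)
      (h.prefixMax.lt.trans_le h.prefixMax.le_last) _ _ _).setReg (by simp) _
    reg_j := h.reg_j
    reg_n := by simp [Store.setReg]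
    prefixMax := h.prefixMax.merge hf hle
    block := (isBlock_setBlock (by ring) (by ring)).setReg _ _ }

theorem MergeInvariant.exit (h : MergeInvariant V s m e σ) (he : IsNextVertex V s m e)
    (hlt : σ.blockSlope (e + 1) < chordSlope s m e) :
    Exec scanMerge σ σ 12 ∧ ScanInvariant V s m σ := by
  rw [← h.block.blockSlope_eq, ← h.reg_j, ← h.reg_n] at hlt
  exact ⟨exec_scanMerge_exit hlt, h.scan.extend he h.block⟩

/-- Amortization: each merge takes time `35` and removes one vertex of the hull, so that
`35 * l.length` is a potential. -/
theorem exec_scanMerge (hs : IsStackDistribution V s) (hl : HullChain V s e l)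
    (h : MergeInvariant V s m e σ) :
    ∃ σ' T l', Exec scanMerge σ σ' T ∧ ScanInvariant V s m σ' ∧ σ'.reg .j = m + 1 ∧
      HullChain V s m l' ∧ T + 35 * l'.length = 35 * l.length + 47 := by
  induction hl generalizing σ with
  | last =>
    have hnext := h.prefixMax.isNextVertex_last
    have hsentinel : σ.blockSlope (V + 1) = 0 := by
      rw [Store.blockSlope, h.scan.pi_last, h.scan.delta_last, zero_div]
    obtain ⟨hexec, hscan⟩ := h.exit hnext (hsentinel ▸ hnext.slope_pos hs)
    exact ⟨σ, 12, [V], hexec, hscan, h.reg_j, .cons hnext .last, rfl⟩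
  | @cons e f l hf hl ih =>
    have hslope := (h.scan.block e f h.prefixMax.lt hf).blockSlope_eq
    rcases le_or_gt (chordSlope s m e) (chordSlope s e f) with hle | hlt
    · obtain ⟨σ', T, l', hexec, hscan, hj, hl', hT⟩ := ih (h.mergeBlock hf hle)
      rw [← h.block.blockSlope_eq, ← hslope, ← h.reg_j, ← h.reg_n] at hle
      refine ⟨σ', T + 35, l', exec_scanMerge_step hle hexec, hscan, hj, hl', ?_⟩
      rw [List.length_cons]
      omega
    · have hnext := h.prefixMax.isNextVertex_of_lt hf hlt
      obtain ⟨hexec, hscan⟩ := h.exit hnext (hslope ▸ hlt)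
      refine ⟨σ, 12, e :: f :: l, hexec, hscan, h.reg_j, .cons hnext (.cons hf hl), ?_⟩
      simp only [List.length_cons]
      omega

theorem exec_mainLoop (hs : IsStackDistribution V s) (hm : m + 1 ≤ V)
    (hl : HullChain V s (m + 1) l) (h : ScanInvariant V s (m + 1) σ)
    (hj : σ.reg .j = m + 1) :
    ∃ σ' T l', Exec mainLoop σ σ' T ∧ ScanInvariant V s 1 σ' ∧ HullChain V s 1 l' ∧
      T + 35 * l'.length = 35 * l.length + 70 * m + 4 := by
  induction m generalizing l σ with
  | zero => exact ⟨σ, 4, l, exec_mainLoop_exit (by omega), h, hl, by omega⟩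
  | succ m ih =>
    obtain ⟨σ₁, T₁, l₁, hmerge, h₁, hj₁, hl₁, hT₁⟩ :=
      exec_scanMerge hs hl (h.openBlock hj (Nat.le_add_left 1 m) hm)
    obtain ⟨σ₂, T₂, l₂, hloop, h₂, hl₂, hT₂⟩ := ih (Nat.le_of_succ_le hm) hl₁
      (h₁.setReg (x := .j) (by simp) (σ₁.reg .j - 1)) (by simp [Store.setReg, hj₁])
    exact ⟨σ₂, _, l₂, exec_mainLoop_step (by omega) hmerge hloop, h₂, hl₂, by omega⟩

theorem exec_scanInit (hσ : IsInput V s σ) :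
    ∃ σ', Exec scanInit σ σ' 20 ∧ ScanInvariant V s V σ' := by
  refine ⟨_, .seq (.setNu ..) (.seq (.setArr ..) (.seq (.setArr ..) (.seq (.setArr ..)
    (.setArr ..)))), ?_⟩
  exact {
    reg_V := hσ.reg_V
    arr_s := by simpa using hσ.arr_s
    out_nil := hσ.out_nil
    nu_one := by simp [NatExpr.eval]
    pi_last := by simp [NatExpr.eval, RealExpr.eval, hσ.reg_V]
    delta_last := by simp [NatExpr.eval, RealExpr.eval, hσ.reg_V]
    block _ _ hi he := absurd he.lt_last hi.not_gt }

theorem exec_scanMain (hs : IsStackDistribution V s) (h : ScanInvariant V s V σ) :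
    ∃ σ' T l, Exec scanMain σ σ' T ∧ ScanInvariant V s 1 σ' ∧ HullChain V s 1 l ∧
      T + 35 * l.length + 64 = 70 * V := by
  obtain ⟨m, rfl⟩ := Nat.exists_eq_add_of_le' hs.one_le
  obtain ⟨σ', T, l, hloop, h', hl, hT⟩ := exec_mainLoop hs le_rfl .last
    (h.setReg (x := .j) (by simp) (σ.reg .V)) (by simp [Store.setReg, h.reg_V])
  refine ⟨σ', _, l, .seq (.setReg ..) hloop, h', hl, ?_⟩
  simp only [NatExpr.cost, List.length_nil] at hT ⊢
  omega

theorem exec_printQLoop (hl : HullChain V s m l) (hV : σ.reg .V = V)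
    (hnu : ∀ i e, m ≤ i → IsNextVertex V s i e → σ.nu (i + 1) = e) (hj : σ.reg .j = m + 1) :
    ∃ σ', Exec printQLoop σ σ' (17 * l.length + 4) ∧ σ'.reg .V = V ∧
      printedQ σ'.out = printedQ σ.out ++ l.zipIdx (σ.reg .i) := by
  induction hl generalizing σ with
  | last => exact ⟨σ, exec_printQLoop_exit (by omega), hV, by simp⟩
  | @cons m e l he _ ih =>
    have hnu_m : σ.nu (σ.reg .j) = e := hj ▸ hnu m e le_rfl he
    obtain ⟨σ', hexec, hV', hout⟩ := ih (σ := σ.printQStep)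
      (by simp [Store.printQStep, Store.setReg, hV])
      (fun i e' hi => hnu i e' (he.lt.le.trans hi))
      (by simp [Store.printQStep, Store.setReg, hnu_m])
    refine ⟨σ', exec_printQLoop_step ?_ hexec, hV', hout.trans ?_⟩
    · rw [hj, hV]
      exact he.lt_last
    · simp [Store.printQStep, Store.setReg, hnu_m, printedQ, List.zipIdx_cons]

theorem exec_scanPrintQ (hs : IsStackDistribution V s) (hl : HullChain V s 1 l)
    (h : ScanInvariant V s 1 σ) :
    ∃ σ', Exec scanPrintQ σ σ' (17 * l.length + 25) ∧ σ'.reg .V = V ∧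
      printedQ σ'.out = (1 :: l).zipIdx 1 := by
  set σ₁ := (σ.setReg .j 1).setReg .i 1 with hσ₁
  obtain ⟨σ', hexec, hV', hout⟩ := exec_printQLoop hl (σ := σ₁.printQStep)
    (by simp [hσ₁, Store.printQStep, Store.setReg, h.reg_V])
    (fun i e hi he => (h.block i e hi he).nu)
    (by simp [hσ₁, Store.printQStep, Store.setReg, h.nu_one])
  refine ⟨σ', Exec.of_eq (.seq (.setReg ..) (.seq (.setReg ..)
    (exec_printQLoop_step (σ := σ₁) ?_ hexec))) rfl ?_, hV', hout.trans ?_⟩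
  · simp [hσ₁, Store.setReg, h.reg_V, hs.one_le]
  · simp only [NatExpr.cost]
    omega
  · simp [hσ₁, Store.printQStep, Store.setReg, printedQ, List.zipIdx_cons, h.nu_one, h.out_nil]

theorem exec_printXiLoop (k : ℕ) (hj : σ.reg .j + k = σ.reg .V + 1) :
    ∃ σ', Exec printXiLoop σ σ' (15 * k + 4) ∧ printedQ σ'.out = printedQ σ.out := by
  induction k generalizing σ with
  | zero => exact ⟨σ, exec_printXiLoop_exit (by omega), rfl⟩
  | succ k ih =>
    obtain ⟨σ', hexec, hout⟩ := ih (σ := σ.printXiStep) (by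
      simp only [Store.printXiStep, Store.setReg, Function.update_self, ne_eq, reduceCtorEq,
        not_false_eq_true, Function.update_of_ne]
      omega)
    exact ⟨σ', exec_printXiLoop_step (by omega) hexec,
      hout.trans (by simp [Store.printXiStep, Store.setReg, printedQ])⟩

theorem exec_scanPrintXi {k : ℕ} (hV : σ.reg .V = k + 1) :
    ∃ σ', Exec scanPrintXi σ σ' (15 * k + 6) ∧ printedQ σ'.out = printedQ σ.out := by
  obtain ⟨σ', hexec, hout⟩ := exec_printXiLoop k (σ := σ.setReg .j 2) (by
    simp only [Store.setReg, Function.update_self, ne_eq, reduceCtorEq, not_false_eq_true,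
      Function.update_of_ne]
    omega)
  refine ⟨σ', Exec.of_eq (.seq (.setReg ..) hexec) rfl ?_, hout⟩
  simp only [NatExpr.cost]
  omega

theorem HullChain.length_add_le (h : HullChain V s m l) : l.length + m ≤ V := by
  induction h with
  | last => simp
  | cons he _ ih =>
    have := he.lt
    rw [List.length_cons]
    omega

theorem exec_grahamScan (hs : IsStackDistribution V s) (hl : HullChain V s 1 l)
    (hσ : IsInput V s σ) :
    ∃ σ' T, Exec grahamScan σ σ' T ∧ printedQ σ'.out = (1 :: l).zipIdx 1 ∧
      V ≤ T ∧ T ≤ 85 * V := by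
  obtain ⟨σ₁, hinit, h₁⟩ := exec_scanInit hσ
  obtain ⟨σ₂, T₂, l₂, hmain, h₂, hl₂, hT₂⟩ := exec_scanMain hs h₁
  obtain rfl := hl₂.unique hl
  obtain ⟨σ₃, hprintQ, hV₃, hout₃⟩ := exec_scanPrintQ hs hl h₂
  have hV := hs.one_le
  obtain ⟨σ₄, hprintXi, hout₄⟩ := exec_scanPrintXi (k := V - 1) (hV₃.trans (by omega))
  have hlength := hl.length_add_le
  exact ⟨σ₄, _, .seq hinit (.seq hmain (.seq hprintQ hprintXi)), hout₄.trans hout₃, by omega,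
    by omega⟩

end Scan

end LRUSM

open LRUSM in
/-- There are absolute constants `c₁, c₂ > 0` such that for every `V ≥ 1` and every stack-distance
distribution `s` on `{1, …, V}` with `s V ≠ 0`, with `q = [q₁, …, q_l]` the increasing list of the
`k ∈ {1, …, V}` for which `ev_k` is a supported efficient policy (so that `q₁ = 1` and `q_l = V`):
the scan prints exactly `q_1, …, q_l`, in time between `c₁ V` and `c₂ V`; and for every capacity
`1 ≤ C ≤ V` exactly one pair of consecutive entries `K`, `L` of `0, q₁, …, q_l` satisfies
`K < C ≤ L`, and for it the `K`-`L` policy is gain optimal for capacity `C`, with a miss rate that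
is the optimum of the average occupancy problem. The entry `0` plays a role only for `C = 1`. -/
theorem mainTheorem2 :
    ∃ c₁ c₂ : ℝ, 0 < c₁ ∧ 0 < c₂ ∧
      ∀ (V : ℕ) [NeZero V] (s : ℕ → ℝ), IsStackDistribution V s →
        ∃ q : List ℕ,
          q.Pairwise (· < ·) ∧
          (∀ k : ℕ, k ∈ q ↔ 1 ≤ k ∧ k ≤ V ∧ IsSupportedEv V s k) ∧
          q.head? = some 1 ∧ q.getLast? = some V ∧
          (∀ σ : Store, IsInput V s σ →
            ∃ (σ' : Store) (T : ℕ), Exec grahamScan σ σ' T ∧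
              printedQ σ'.out = q.zipIdx 1 ∧
              c₁ * V ≤ T ∧ T ≤ c₂ * V) ∧
          ∀ C : ℕ, 1 ≤ C → C ≤ V →
            ∃ K L : ℕ,
              (∀ K' L' : ℕ, ([K', L'] <:+: 0 :: q ∧ K' < C ∧ C ≤ L') ↔ K' = K ∧ L' = L) ∧
              ∃ M : ℝ, IsGainOptimal (V := V) s C (klPolicy C K L) M ∧
                IsAverageOccupancyOptimum V s C M := by
  refine ⟨1, 85, one_pos, by norm_num, fun V _ s hs => ?_⟩
  obtain ⟨l, hl⟩ := exists_hullChain s hs.one_le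
  refine ⟨1 :: l, hl.pairwise, hl.mem_one_cons_iff hs, rfl, hl.getLast?_cons, fun σ hσ => ?_,
    fun C hC hCV => ?_⟩
  · obtain ⟨σ', T, hexec, hout, hVT, hTV⟩ := exec_grahamScan hs hl hσ
    exact ⟨σ', T, hexec, hout, by rw [one_mul]; exact_mod_cast hVT, by exact_mod_cast hTV⟩
  · have hpairwise : (0 :: 1 :: l).Pairwise (· < ·) :=
      List.pairwise_cons.2 ⟨fun k hk => (hl.mem_Icc k hk).1, hl.pairwise⟩
    obtain ⟨K, L, hKL⟩ := exists_forall_infix_pair_iff hpairwise hC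
      (List.mem_of_getLast? hl.getLast?_cons) hCV
    obtain ⟨hinfix, hKC, hCL⟩ := (hKL K L).2 ⟨rfl, rfl⟩
    obtain ⟨r, w, hsegment⟩ := hl.exists_isSupportingSegment_zero_cons hs hinfix
    exact ⟨K, L, hKL, w - r * C, hsegment.klPolicy_isGainOptimal hs hKC hCL,
      hsegment.isAverageOccupancyOptimum hs hKC hCL⟩
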